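/- Terminology. All lattices are finite. An element $x$ of a lattice is reducible if $x=y\vee z$ or $x=y\wedge z$ for some $y,z$ both different from $x$. A block is a lattice whose least element $0$ and greatest element $1$ are both reducible; a maximal block is a block $\mathbf B$ occurring in a decomposition $L=C\oplus\mathbf B\oplus C'$ of a lattice $L$ as a linear sum, with $C,C'$ (possibly empty) chains (so every block is a maximal block). The nullity of a poset is the nullity (number of edges minus number of vertices plus number of connected components) of its cover graph. For a finite poset $P$ let $\mathrm{Irr}(P)$ be the set of elements with at most one lower cover and at most one upper cover in $P$. An element $x\in \mathrm{Irr}(P)$ is retractible if either there are no $y,z\in P\setminus\mathrm{Irr}(P)$ with $y\prec x\prec z$, or there are such $y,z$ and there is no directed path of coverings from $y$ to $z$ in $P$ other than $y\prec x\prec z$. The basic retract associated to $P$ is obtained from $P$ by successively removing retractible elements until none is left, and the basic block associated to $P$ is obtained from the basic retract by successively removing pendant vertices (vertices of degree one in the cover graph) until none is left. The height of a finite poset is the length (number of coverings) of a longest chain. Let $\mathscr B(j;5,3,7)$ be the class, up to isomorphism, of all maximal blocks with $j$ elements that have exactly five reducible elements, these being pairwise comparable, that have nullity $3$, and whose associated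 basic block has height $7$. Let $P_n^k$ denote the number of partitions of the integer $n$ into exactly $k$ positive parts. Theorem. For every integer $j\ge 11$, $$|\mathscr B(j;5,3,7)|=\sum_{u=4}^{j-7}\ \sum_{r=0}^{u-4}\ \sum_{l=4}^{j-u-3}2\,P^2_{u-r-2}\,P^2_{l-2}\,P^2_{j-u-l-1}.$$ -/

import Mathlib

namespace LatticeCount

section LatticeNotions

variable {α : Type*} [Lattice α]

/-- `x` is join-reducible: `x = y ⊔ z` for some `y, z` both distinct from `x`. -/
def IsJoinReducible (x : α) : Prop := ∃ y z : α, y ≠ x ∧ z ≠ x ∧ y ⊔ z = x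

/-- `x` is meet-reducible: `x = y ⊓ z` for some `y, z` both distinct from `x`. -/
def IsMeetReducible (x : α) : Prop := ∃ y z : α, y ≠ x ∧ z ≠ x ∧ y ⊓ z = x

/-- `x` is reducible: it is join-reducible or meet-reducible. -/
def IsReducible (x : α) : Prop := IsJoinReducible x ∨ IsMeetReducible x

/-- The set `Red(L)` of all reducible elements of a lattice. -/
def red (α : Type*) [Lattice α] : Set α := {x | IsReducible x}

/-- A block: a lattice in which the least element and the greatest element are reducible.
(The blocks are exactly the lattices `B` that occur as the maximal block of some lattice
`L = C ⊕ B ⊕ C'` with `C`, `C'` (possibly empty) chains.) -/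
def IsBlock (α : Type*) [Lattice α] : Prop :=
  (∃ x : α, IsBot x ∧ IsReducible x) ∧ (∃ x : α, IsTop x ∧ IsReducible x)

end LatticeNotions

/-- The nullity `m - n + c` of a graph with `m` edges, `n` vertices and `c` connected
components. -/
noncomputable def graphNullity {V : Type*} (G : SimpleGraph V) : ℤ :=
  (G.edgeSet.ncard : ℤ) - (Nat.card V : ℤ) + (Nat.card G.ConnectedComponent : ℤ)

/-- The nullity of a poset: the nullity of its cover graph. -/
noncomputable def nullity (P : Type*) [PartialOrder P] : ℤ :=
  graphNullity (SimpleGraph.hasse P)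

section PosetNotions

variable {P : Type*} [PartialOrder P]

/-- `x ∈ Irr(P)`: `x` has at most one lower cover and at most one upper cover in `P`. -/
def IsIrr (x : P) : Prop := {y | y ⋖ x}.Subsingleton ∧ {y | x ⋖ y}.Subsingleton

/-- There is a directed path (a finite sequence of successive upper covers) from `y` to `z` that
does not go through `x`. When `x` is in `Irr(P)` and `y ⋖ x ⋖ z`, these are precisely the
directed paths from `y` to `z` other than `y ⋖ x ⋖ z`. -/
def HasPathAvoiding (x y z : P) : Prop :=
  Relation.TransGen (fun u v : P => u ⋖ v ∧ u ≠ x ∧ v ≠ x) y z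

/-- `x ∈ Irr(P)` is retractible if either there are no `y, z ∉ Irr(P)` with `y ⋖ x ⋖ z`, or there
are such `y, z` and there is no other directed path from `y` to `z` in `P`. -/
def IsRetractible (x : P) : Prop :=
  IsIrr x ∧
    ((¬ ∃ y z : P, ¬ IsIrr y ∧ ¬ IsIrr z ∧ y ⋖ x ∧ x ⋖ z) ∨
      ∃ y z : P, ¬ IsIrr y ∧ ¬ IsIrr z ∧ y ⋖ x ∧ x ⋖ z ∧ ¬ HasPathAvoiding x y z)

/-- A pendant vertex: a vertex of degree one in the cover graph. -/
def IsPendant (x : P) : Prop := ((SimpleGraph.hasse P).neighborSet x).ncard = 1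

/-- The subposet `T` is obtained from the subposet `S` of `P` by removing one retractible element
of `S`. -/
def RetractStep (S T : Set P) : Prop := ∃ x : S, IsRetractible x ∧ T = S \ {(x : P)}

/-- The subposet `T` is obtained from the subposet `S` of `P` by removing one pendant vertex of
`S`. -/
def PendantStep (S T : Set P) : Prop := ∃ x : S, IsPendant x ∧ T = S \ {(x : P)}

/-- The subposet `R` is a basic retract associated to `P`: it is obtained from `P` by successive
removal of retractible elements until there are none left. -/
def IsAssocBasicRetract (R : Set P) : Prop :=
  Relation.ReflTransGen RetractStep Set.univ R ∧ ∀ x : R, ¬ IsRetractible x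

/-- The subposet `B` is a basic block associated to `P`: it is obtained from a basic retract
associated to `P` by successive removal of pendant vertices until there are none left. -/
def IsAssocBasicBlock (B : Set P) : Prop :=
  ∃ R : Set P, IsAssocBasicRetract R ∧ Relation.ReflTransGen PendantStep R B ∧
    ∀ x : B, ¬ IsPendant x

end PosetNotions

/-- A finite lattice with `j` elements. -/
structure FiniteLattice (j : ℕ) where
  carrier : Type
  [lattice : Lattice carrier]
  [finite : Finite carrier]
  card_eq : Nat.card carrier = j

attribute [instance] FiniteLattice.lattice FiniteLattice.finite

/-- Membership in `𝓑(j; r, k, h)`: `L` is a block on `j` elements, has exactly `r` reducible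
elements, these are pairwise comparable, `L` has nullity `k`, and the basic block associated to
`L` has height `h` (the height of a finite poset being the length of a longest chain). -/
def MemB (j r k h : ℕ) (L : FiniteLattice j) : Prop :=
  IsBlock L.carrier ∧
  (red L.carrier).ncard = r ∧
  IsChain (· ≤ ·) (red L.carrier) ∧
  nullity L.carrier = k ∧
  ∃ B : Set L.carrier, IsAssocBasicBlock B ∧ Order.krullDim B = h

/-- Order isomorphism on the members of `𝓑(j; r, k, h)`. -/
def isoSetoid (j r k h : ℕ) : Setoid {L : FiniteLattice j // MemB j r k h L} where
  r L M := Nonempty (L.1.carrier ≃o M.1.carrier)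
  iseqv :=
    { refl := fun _ => ⟨OrderIso.refl _⟩
      symm := fun ⟨e⟩ => ⟨e.symm⟩
      trans := fun ⟨e⟩ ⟨f⟩ => ⟨e.trans f⟩ }

/-- `|𝓑(j; r, k, h)|`: the number of isomorphism classes. -/
noncomputable def numB (j r k h : ℕ) : ℕ := Nat.card (Quotient (isoSetoid j r k h))

/-- `P_n^k`: the number of partitions of the integer `n` into exactly `k` positive parts. -/
def numPartitions (n k : ℕ) : ℕ :=
  (Finset.univ.filter fun p : n.Partition => Multiset.card p.parts = k).card

end LatticeCount

-- Let `r 0 < ... < r 4` be the reducible elements of a member of the class, and call the open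
-- interval between `r i` and `r (i + 1)` doubled when it is not a chain. The number of doubled
-- intervals is squeezed from both sides.
--
-- Nullity bounds it above. In a block an irreducible element has exactly one upper cover, so the
-- nullity is the sum over the four `r i` below the top of the number of upper covers minus one
-- (`nullity_eq_sum`), and each doubled interval contributes at least 1.
--
-- Height bounds it below. Retractions preserve reducibility and a block never acquires pendant
-- vertices, so the basic block is the basic retract. There every irreducible element is the middle
-- of a diamond with reducible ends, and the height is at most 4 plus the number of doubled
-- intervals (`IsAssocBasicRetract.length_le`).
--
-- Height 7 and nullity 3 thus force exactly three doubled intervals and leave no cover to spare.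
-- Consequently every element is comparable with every `r i`, each interval splits into at most two
-- mutually incomparable chains, and the lattice is a `Model` given by its chain lengths
-- (`exists_orderIso_model`). Since 0 and 1 are reducible, the first and last intervals are doubled,
-- so the undoubled one is one of the two in the middle: the factor 2. Conversely such models belong
-- to the class, and isomorphic ones have equal lengths (`Model.eq_of_orderIso`). In the sum, `r` is
-- the size of the undoubled interval, and the doubled ones have `u - r - 2`, `l - 2` and `j - u - l
-- - 1` elements, each split into two positive parts.

namespace LatticeCount

-- Covers in subposets and the effect of deleting a retractible element

section Covers

variable {P : Type*} [PartialOrder P]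

/-- `b` covers `a` in the subposet `S`. -/
def CovIn (S : Set P) (a b : P) : Prop := a ∈ S ∧ b ∈ S ∧ a < b ∧ ∀ c ∈ S, a < c → ¬ c < b

/-- `a` has two upper covers in `S`. -/
def TwoUp (S : Set P) (a : P) : Prop := ∃ u v, u ≠ v ∧ CovIn S a u ∧ CovIn S a v

/-- `a` has two lower covers in `S`. -/
def TwoDown (S : Set P) (a : P) : Prop := ∃ u v, u ≠ v ∧ CovIn S u a ∧ CovIn S v a

lemma covBy_iff_covIn {S : Set P} {a b : S} : a ⋖ b ↔ CovIn S (a : P) b := by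
  constructor
  · rintro ⟨h1, h2⟩
    exact ⟨a.2, b.2, h1, fun c hc h3 h4 => h2 (c := ⟨c, hc⟩) h3 h4⟩
  · rintro ⟨-, -, h1, h2⟩
    exact ⟨h1, fun c h3 h4 => h2 c c.2 h3 h4⟩

lemma covIn_univ_iff {a b : P} : CovIn Set.univ a b ↔ a ⋖ b := by
  simp [CovIn, CovBy]

lemma CovIn.eq_of_le {S : Set P} {a b c : P} (h : CovIn S a b) (hc : c ∈ S) (h1 : a < c)
    (h2 : c ≤ b) : c = b :=
  h2.eq_of_not_lt (h.2.2.2 c hc h1)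

lemma CovIn.eq_of_ge {S : Set P} {a b c : P} (h : CovIn S a b) (hc : c ∈ S) (h1 : a ≤ c)
    (h2 : c < b) : a = c :=
  h1.eq_of_not_lt fun h3 => h.2.2.2 c hc h3 h2

lemma isIrr_iff {S : Set P} {x : S} : IsIrr x ↔ ¬ TwoUp S (x : P) ∧ ¬ TwoDown S (x : P) := by
  constructor
  · rintro ⟨h1, h2⟩
    refine ⟨?_, ?_⟩
    · rintro ⟨u, v, huv, hu, hv⟩
      have := @h2 ⟨u, hu.2.1⟩ (covBy_iff_covIn.2 hu) ⟨v, hv.2.1⟩ (covBy_iff_covIn.2 hv)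
      exact huv (congrArg Subtype.val this)
    · rintro ⟨u, v, huv, hu, hv⟩
      have := @h1 ⟨u, hu.1⟩ (covBy_iff_covIn.2 hu) ⟨v, hv.1⟩ (covBy_iff_covIn.2 hv)
      exact huv (congrArg Subtype.val this)
  · rintro ⟨h1, h2⟩
    refine ⟨fun u hu v hv => ?_, fun u hu v hv => ?_⟩
    · by_contra h
      exact h2 ⟨u, v, fun h' => h (Subtype.ext h'), covBy_iff_covIn.1 hu, covBy_iff_covIn.1 hv⟩
    · by_contra h
      exact h1 ⟨u, v, fun h' => h (Subtype.ext h'), covBy_iff_covIn.1 hu, covBy_iff_covIn.1 hv⟩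

variable [Finite P]

lemma exists_covIn_le {S : Set P} {a b : P} (ha : a ∈ S) (hb : b ∈ S) (h : a < b) :
    ∃ c, CovIn S a c ∧ c ≤ b := by
  obtain ⟨c, hc⟩ := (Set.toFinite {c | c ∈ S ∧ a < c ∧ c ≤ b}).exists_minimal ⟨b, hb, h, le_rfl⟩
  refine ⟨c, ⟨ha, hc.prop.1, hc.prop.2.1, fun d hd h1 h2 => ?_⟩, hc.prop.2.2⟩
  exact hc.not_lt ⟨hd, h1, h2.le.trans hc.prop.2.2⟩ h2

lemma exists_ge_covIn {S : Set P} {a b : P} (ha : a ∈ S) (hb : b ∈ S) (h : a < b) :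
    ∃ c, CovIn S c b ∧ a ≤ c := by
  obtain ⟨c, hc⟩ := (Set.toFinite {c | c ∈ S ∧ a ≤ c ∧ c < b}).exists_maximal ⟨a, ha, le_rfl, h⟩
  refine ⟨c, ⟨hc.prop.1, hb, hc.prop.2.2, fun d hd h1 h2 => ?_⟩, hc.prop.2.1⟩
  exact hc.not_gt ⟨hd, hc.prop.2.1.trans h1.le, h2⟩ h1

/-- A saturated chain from `a` to `b` stays inside the interval, which misses `x`. -/
lemma hasPathAvoiding_of_lt {x a b : P} (h : a < b) (hx : ¬ (a ≤ x ∧ x ≤ b)) :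
    HasPathAvoiding x a b := by
  induction b using WellFoundedLT.induction with
  | ind b ih =>
    obtain ⟨c, hc, hac⟩ := exists_ge_covIn (Set.mem_univ a) (Set.mem_univ b) h
    have hcb := covIn_univ_iff.1 hc
    have hbx : b ≠ x := by rintro rfl; exact hx ⟨h.le, le_rfl⟩
    have hcx : c ≠ x := by rintro rfl; exact hx ⟨hac, hcb.le⟩
    rcases hac.eq_or_lt with rfl | hlt
    · exact Relation.TransGen.single ⟨hcb, hcx, hbx⟩
    · exact Relation.TransGen.tail (ih c hcb.lt hlt fun h' => hx ⟨h'.1, h'.2.trans hcb.le⟩)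
        ⟨hcb, hcx, hbx⟩

lemma CovIn.le_of_not_twoUp {S : Set P} {x z w : P} (h : ¬ TwoUp S x) (hz : CovIn S x z)
    (hw : w ∈ S) (hxw : x < w) : z ≤ w := by
  obtain ⟨c, hc, hcw⟩ := exists_covIn_le hz.1 hw hxw
  by_contra h'
  exact h ⟨c, z, by rintro rfl; exact h' hcw, hc, hz⟩

lemma CovIn.ge_of_not_twoDown {S : Set P} {x y w : P} (h : ¬ TwoDown S x) (hy : CovIn S y x)
    (hw : w ∈ S) (hxw : w < x) : w ≤ y := by
  obtain ⟨c, hc, hcw⟩ := exists_ge_covIn hw hy.2.1 hxw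
  by_contra h'
  exact h ⟨c, y, by rintro rfl; exact h' hcw, hc, hy⟩

/-- A retractible element that is neither minimal nor maximal is the only element strictly between
its two neighbours. -/
lemma IsRetractible.eq_of_between {S : Set P} {x : S} (hx : IsRetractible x) {y z w : P}
    (hy : CovIn S y x) (hz : CovIn S x z) (hw : w ∈ S) (hyw : y < w) (hwz : w < z) : w = x := by
  obtain ⟨hirr, hr⟩ := hx
  have hirr' := isIrr_iff.1 hirr
  by_contra hne
  have h1 : ¬ w ≤ x := fun h => by
    have := hy.ge_of_not_twoDown hirr'.2 hw (lt_of_le_of_ne h hne)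
    exact this.not_gt hyw
  have h2 : ¬ (x : P) ≤ w := fun h => by
    have := hz.le_of_not_twoUp hirr'.1 hw (lt_of_le_of_ne h (Ne.symm hne))
    exact this.not_gt hwz
  -- An intermediate `w ≠ x` defeats both clauses: it makes `y` and `z` non-irreducible, and it
  -- gives a second path from `y` to `z`.
  rcases hr with hr | ⟨y', z', -, -, hy', hz', hp⟩
  · apply hr
    refine ⟨⟨y, hy.1⟩, ⟨z, hz.2.1⟩, ?_, ?_, covBy_iff_covIn.2 hy, covBy_iff_covIn.2 hz⟩
    · rw [isIrr_iff]
      rintro ⟨h, -⟩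
      exact h2 (hy.le_of_not_twoUp h hw hyw)
    · rw [isIrr_iff]
      rintro ⟨-, h⟩
      exact h1 (hz.ge_of_not_twoDown h hw hwz)
  · have ey : y' = ⟨y, hy.1⟩ := hirr.1 hy' (covBy_iff_covIn.2 hy)
    have ez : z' = ⟨z, hz.2.1⟩ := hirr.2 hz' (covBy_iff_covIn.2 hz)
    subst ey ez
    apply hp
    have a1 : HasPathAvoiding x (⟨y, hy.1⟩ : S) ⟨w, hw⟩ :=
      hasPathAvoiding_of_lt hyw fun h => h2 h.2
    have a2 : HasPathAvoiding x (⟨w, hw⟩ : S) ⟨z, hz.2.1⟩ :=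
      hasPathAvoiding_of_lt hwz fun h => h1 h.1
    exact Relation.TransGen.trans a1 a2

/-- Only `x` lies strictly between its neighbours, so its deletion merges the two coverings at `x`
into one and changes nothing else. -/
lemma covIn_diff_iff {S : Set P} {x : S} (hx : IsRetractible x) {y z : P}
    (hy : CovIn S y x) (hz : CovIn S x z) {a b : P} :
    CovIn (S \ {(x : P)}) a b ↔ (a ≠ x ∧ b ≠ x ∧ CovIn S a b) ∨ (a = y ∧ b = z) := by
  have hirr' := isIrr_iff.1 hx.1
  constructor
  · rintro ⟨⟨ha, ha'⟩, ⟨hb, hb'⟩, hab, h⟩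
    by_cases hc : a < x ∧ (x : P) < b
    · right
      have h1 := hy.ge_of_not_twoDown hirr'.2 ha hc.1
      have h2 := hz.le_of_not_twoUp hirr'.1 hb hc.2
      constructor
      · by_contra hne
        exact h y ⟨hy.1, hy.2.2.1.ne⟩ (lt_of_le_of_ne h1 hne) (hy.2.2.1.trans hc.2)
      · by_contra hne
        exact h z ⟨hz.2.1, hz.2.2.1.ne'⟩ (hc.1.trans hz.2.2.1) (lt_of_le_of_ne h2 (Ne.symm hne))
    · left
      refine ⟨ha', hb', ha, hb, hab, fun c hc' h1 h2 => ?_⟩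
      by_cases hcx : c = x
      · exact hc ⟨hcx ▸ h1, hcx ▸ h2⟩
      · exact h c ⟨hc', hcx⟩ h1 h2
  · rintro (⟨ha, hb, h⟩ | ⟨rfl, rfl⟩)
    · exact ⟨⟨h.1, ha⟩, ⟨h.2.1, hb⟩, h.2.2.1, fun c hc => h.2.2.2 c hc.1⟩
    · refine ⟨⟨hy.1, hy.2.2.1.ne⟩, ⟨hz.2.1, hz.2.2.1.ne'⟩, hy.2.2.1.trans hz.2.2.1,
        fun c hc h1 h2 => hc.2 (hx.eq_of_between hy hz hc.1 h1 h2)⟩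

/-- At `y` the lost cover `x` is replaced by `z`, which was not a cover before, so the number of
covers is unchanged. -/
lemma twoUp_diff_iff {S : Set P} {x : S} (hx : IsRetractible x) {y z : P}
    (hy : CovIn S y x) (hz : CovIn S x z) {a : P} (ha : a ≠ x) :
    TwoUp (S \ {(x : P)}) a ↔ TwoUp S a := by
  have hirr' := isIrr_iff.1 hx.1
  have hxz : z ≠ x := hz.2.2.1.ne'
  have key : ∀ b, CovIn (S \ {(x : P)}) a b ↔ (b ≠ x ∧ CovIn S a b) ∨ (a = y ∧ b = z) := by
    intro b; rw [covIn_diff_iff hx hy hz]; simp [ha]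
  have hxy : CovIn S a x → a = y := fun h => by
    by_contra h'; exact hirr'.2 ⟨a, y, h', h, hy⟩
  have hnz : ¬ CovIn S y z := fun h => h.2.2.2 x x.2 hy.2.2.1 hz.2.2.1
  constructor
  · rintro ⟨u, v, huv, hu, hv⟩
    rw [key] at hu hv
    rcases hu with ⟨hux, hu⟩ | ⟨rfl, rfl⟩ <;> rcases hv with ⟨hvx, hv⟩ | ⟨e, e'⟩
    · exact ⟨u, v, huv, hu, hv⟩
    · subst e e'; exact ⟨u, x, hux, hu, hy⟩
    · exact ⟨x, v, Ne.symm hvx, hy, hv⟩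
    · exact absurd e'.symm huv
  · rintro ⟨u, v, huv, hu, hv⟩
    by_cases h1 : u = x
    · subst h1
      have := hxy hu; subst this
      refine ⟨z, v, ?_, (key _).2 (Or.inr ⟨rfl, rfl⟩), (key _).2 (Or.inl ⟨Ne.symm huv, hv⟩)⟩
      rintro rfl; exact hnz hv
    · by_cases h2 : v = x
      · subst h2
        have := hxy hv; subst this
        refine ⟨u, z, ?_, (key _).2 (Or.inl ⟨huv, hu⟩), (key _).2 (Or.inr ⟨rfl, rfl⟩)⟩
        rintro rfl; exact hnz hu
      · exact ⟨u, v, huv, (key _).2 (Or.inl ⟨h1, hu⟩), (key _).2 (Or.inl ⟨h2, hv⟩)⟩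

lemma twoDown_diff_iff {S : Set P} {x : S} (hx : IsRetractible x) {y z : P}
    (hy : CovIn S y x) (hz : CovIn S x z) {a : P} (ha : a ≠ x) :
    TwoDown (S \ {(x : P)}) a ↔ TwoDown S a := by
  have hirr' := isIrr_iff.1 hx.1
  have key : ∀ b, CovIn (S \ {(x : P)}) b a ↔ (b ≠ x ∧ CovIn S b a) ∨ (b = y ∧ a = z) := by
    intro b; rw [covIn_diff_iff hx hy hz]; simp [ha]
  have hxy : CovIn S x a → a = z := fun h => by
    by_contra h'; exact hirr'.1 ⟨a, z, h', h, hz⟩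
  have hnz : ¬ CovIn S y z := fun h => h.2.2.2 x x.2 hy.2.2.1 hz.2.2.1
  constructor
  · rintro ⟨u, v, huv, hu, hv⟩
    rw [key] at hu hv
    rcases hu with ⟨hux, hu⟩ | ⟨rfl, rfl⟩ <;> rcases hv with ⟨hvx, hv⟩ | ⟨e, e'⟩
    · exact ⟨u, v, huv, hu, hv⟩
    · subst e e'; exact ⟨u, x, hux, hu, hz⟩
    · exact ⟨x, v, Ne.symm hvx, hz, hv⟩
    · exact absurd e.symm huv
  · rintro ⟨u, v, huv, hu, hv⟩
    by_cases h1 : u = x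
    · subst h1
      have := hxy hu; subst this
      refine ⟨y, v, ?_, (key _).2 (Or.inr ⟨rfl, rfl⟩), (key _).2 (Or.inl ⟨Ne.symm huv, hv⟩)⟩
      rintro rfl; exact hnz hv
    · by_cases h2 : v = x
      · subst h2
        have := hxy hv; subst this
        refine ⟨u, y, ?_, (key _).2 (Or.inl ⟨huv, hu⟩), (key _).2 (Or.inr ⟨rfl, rfl⟩)⟩
        rintro rfl; exact hnz hu
      · exact ⟨u, v, huv, (key _).2 (Or.inl ⟨h1, hu⟩), (key _).2 (Or.inl ⟨h2, hv⟩)⟩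

/-- Every finite poset has an associated basic retract. -/
lemma exists_isAssocBasicRetract (P : Type*) [PartialOrder P] [Finite P] :
    ∃ R : Set P, IsAssocBasicRetract R := by
  obtain ⟨R, hR⟩ := (Set.toFinite {S : Set P | Relation.ReflTransGen RetractStep Set.univ S}).exists_minimal
    ⟨Set.univ, Relation.ReflTransGen.refl⟩
  refine ⟨R, hR.prop, fun x hx => ?_⟩
  have hlt : R \ {(x : P)} < R :=
    lt_of_le_of_ne Set.sdiff_subset fun h => (h.ge x.2).2 rfl
  exact hR.not_lt (hR.prop.tail ⟨x, hx, rfl⟩) hlt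

end Covers

-- Basic retracts of blocks

section Retract

variable {L : Type*} [Lattice L]

/-- A subset containing the reducible elements, on which reducibility can be read off from the
covers inside the subset. -/
def KeepsReducibility (S : Set L) : Prop :=
  red L ⊆ S ∧ ∀ a ∈ S, (TwoUp S a ↔ IsMeetReducible a) ∧ (TwoDown S a ↔ IsJoinReducible a)

lemma KeepsReducibility.isIrr_iff {S : Set L} (hS : KeepsReducibility S) {x : S} :
    IsIrr x ↔ (x : L) ∉ red L := by
  rw [LatticeCount.isIrr_iff, (hS.2 x x.2).1, (hS.2 x x.2).2]
  simp only [red, IsReducible, Set.mem_ofPred_eq]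
  tauto

variable [Finite L]

lemma twoUp_univ_iff {a : L} : TwoUp Set.univ a ↔ IsMeetReducible a := by
  constructor
  · rintro ⟨u, v, huv, hu, hv⟩
    refine ⟨u, v, hu.2.2.1.ne', hv.2.2.1.ne', ?_⟩
    refine (hu.eq_of_ge trivial (le_inf hu.2.2.1.le hv.2.2.1.le) ?_).symm
    refine lt_of_le_of_ne inf_le_left fun h => huv ?_
    exact hv.eq_of_le trivial hu.2.2.1 (inf_eq_left.1 h)
  · rintro ⟨y, z, hy, hz, rfl⟩
    obtain ⟨u, hu, huy⟩ := exists_covIn_le (Set.mem_univ (y ⊓ z)) (Set.mem_univ y)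
      (lt_of_le_of_ne inf_le_left (Ne.symm hy))
    obtain ⟨v, hv, hvz⟩ := exists_covIn_le (Set.mem_univ (y ⊓ z)) (Set.mem_univ z)
      (lt_of_le_of_ne inf_le_right (Ne.symm hz))
    refine ⟨u, v, ?_, hu, hv⟩
    rintro rfl
    exact (le_inf huy hvz).not_gt hu.2.2.1

lemma twoDown_univ_iff {a : L} : TwoDown Set.univ a ↔ IsJoinReducible a := by
  constructor
  · rintro ⟨u, v, huv, hu, hv⟩
    refine ⟨u, v, hu.2.2.1.ne, hv.2.2.1.ne, ?_⟩
    refine hu.eq_of_le trivial ?_ (sup_le hu.2.2.1.le hv.2.2.1.le)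
    refine lt_of_le_of_ne le_sup_left fun h => huv ?_
    exact (hv.eq_of_ge trivial (sup_eq_left.1 h.symm) hu.2.2.1).symm
  · rintro ⟨y, z, hy, hz, rfl⟩
    obtain ⟨u, hu, huy⟩ := exists_ge_covIn (Set.mem_univ y) (Set.mem_univ (y ⊔ z))
      (lt_of_le_of_ne le_sup_left hy)
    obtain ⟨v, hv, hvz⟩ := exists_ge_covIn (Set.mem_univ z) (Set.mem_univ (y ⊔ z))
      (lt_of_le_of_ne le_sup_right hz)
    refine ⟨u, v, ?_, hu, hv⟩
    rintro rfl
    exact (sup_le huy hvz).not_gt hu.2.2.1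

/-- The extreme elements of a block are reducible and hence stay in `S`. This supplies the two
neighbours that the deletion lemmas require. -/
lemma KeepsReducibility.exists_covs (hL : IsBlock L) {S : Set L} (hS : KeepsReducibility S)
    {x : L} (hxS : x ∈ S) (hx : x ∉ red L) : (∃ y, CovIn S y x) ∧ (∃ z, CovIn S x z) := by
  obtain ⟨⟨b, hb, hb'⟩, ⟨t, ht, ht'⟩⟩ := hL
  constructor
  · obtain ⟨y, hy, -⟩ := exists_ge_covIn (hS.1 hb') hxS
      (lt_of_le_of_ne (hb x) (by rintro rfl; exact hx hb'))
    exact ⟨y, hy⟩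
  · obtain ⟨y, hy, -⟩ := exists_covIn_le hxS (hS.1 ht')
      (lt_of_le_of_ne (ht x) (by rintro rfl; exact hx ht'))
    exact ⟨y, hy⟩

lemma KeepsReducibility.retractStep (hL : IsBlock L) {S T : Set L} (hS : KeepsReducibility S)
    (h : RetractStep S T) : KeepsReducibility T := by
  obtain ⟨x, hx, rfl⟩ := h
  have hxr : (x : L) ∉ red L := hS.isIrr_iff.1 hx.1
  obtain ⟨⟨y, hy⟩, ⟨z, hz⟩⟩ := hS.exists_covs hL x.2 hxr
  refine ⟨fun a ha => ⟨hS.1 ha, by rintro rfl; exact hxr ha⟩, fun a ha => ?_⟩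
  rw [twoUp_diff_iff hx hy hz ha.2, twoDown_diff_iff hx hy hz ha.2]
  exact hS.2 a ha.1

lemma IsAssocBasicRetract.keepsReducibility (hL : IsBlock L) {R : Set L}
    (hR : IsAssocBasicRetract R) : KeepsReducibility R := by
  obtain ⟨h, -⟩ := hR
  induction h with
  | refl =>
    exact ⟨Set.subset_univ _, fun a _ => ⟨twoUp_univ_iff, twoDown_univ_iff⟩⟩
  | tail _ h ih => exact ih.retractStep hL h

/-- A reducible element has two neighbours on one side, an irreducible one has a neighbour on each
side. -/
lemma KeepsReducibility.not_isPendant (hL : IsBlock L) {S : Set L} (hS : KeepsReducibility S)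
    (x : S) : ¬ IsPendant x := by
  intro h
  obtain ⟨n, hn⟩ := Set.ncard_eq_one.1 h
  have key : ∀ u v : S, (x ⋖ u ∨ u ⋖ x) → (x ⋖ v ∨ v ⋖ x) → u = v := by
    intro u v hu hv
    have h1 : u ∈ (SimpleGraph.hasse S).neighborSet x := by simpa using hu
    have h2 : v ∈ (SimpleGraph.hasse S).neighborSet x := by simpa using hv
    rw [hn] at h1 h2
    exact h1.trans h2.symm
  by_cases hx : (x : L) ∈ red L
  · have hx' := hx
    rcases hx' with hx' | hx'
    · obtain ⟨u, v, huv, hu, hv⟩ := (hS.2 x x.2).2.2 hx'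
      exact huv (congrArg Subtype.val (key ⟨u, hu.1⟩ ⟨v, hv.1⟩ (Or.inr (covBy_iff_covIn.2 hu))
        (Or.inr (covBy_iff_covIn.2 hv))))
    · obtain ⟨u, v, huv, hu, hv⟩ := (hS.2 x x.2).1.2 hx'
      exact huv (congrArg Subtype.val (key ⟨u, hu.2.1⟩ ⟨v, hv.2.1⟩ (Or.inl (covBy_iff_covIn.2 hu))
        (Or.inl (covBy_iff_covIn.2 hv))))
  · obtain ⟨⟨y, hy⟩, ⟨z, hz⟩⟩ := hS.exists_covs hL x.2 hx
    have := congrArg Subtype.val (key ⟨y, hy.1⟩ ⟨z, hz.2.1⟩ (Or.inr (covBy_iff_covIn.2 hy))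
      (Or.inl (covBy_iff_covIn.2 hz)))
    exact (hy.2.2.1.trans hz.2.2.1).ne this

lemma isAssocBasicBlock_iff (hL : IsBlock L) {B : Set L} :
    IsAssocBasicBlock B ↔ IsAssocBasicRetract B := by
  constructor
  · rintro ⟨R, hR, h, -⟩
    rcases h.cases_head with rfl | ⟨T, ⟨x, hx, -⟩, -⟩
    · exact hR
    · exact absurd hx ((hR.keepsReducibility hL).not_isPendant hL x)
  · intro h
    exact ⟨B, h, Relation.ReflTransGen.refl, (h.keepsReducibility hL).not_isPendant hL⟩

/-- In a basic retract an irreducible element is the middle of a diamond. -/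
lemma IsAssocBasicRetract.exists_diamond (hL : IsBlock L) {R : Set L}
    (hR : IsAssocBasicRetract R) {x : L} (hxR : x ∈ R) (hx : x ∉ red L) :
    ∃ y ∈ red L, ∃ z ∈ red L, CovIn R y x ∧ CovIn R x z ∧ (∀ w ∈ R, w < x → w ≤ y) ∧
      (∀ w ∈ R, x < w → z ≤ w) ∧ ∃ w ∈ R, y < w ∧ w < z ∧ ¬ w ≤ x ∧ ¬ x ≤ w := by
  have hk := hR.keepsReducibility hL
  have hirr : IsIrr (⟨x, hxR⟩ : R) := hk.isIrr_iff.2 hx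
  have hirr' := isIrr_iff.1 hirr
  have hn := hR.2 ⟨x, hxR⟩
  rw [IsRetractible, not_and_or, not_or] at hn
  obtain ⟨h1, h2⟩ := hn.resolve_left (not_not_intro hirr)
  rw [not_not] at h1
  obtain ⟨y, z, hy, hz, hyx, hxz⟩ := h1
  have hp : HasPathAvoiding (⟨x, hxR⟩ : R) y z := by
    by_contra h; exact h2 ⟨y, z, hy, hz, hyx, hxz, h⟩
  have hyx' := covBy_iff_covIn.1 hyx
  have hxz' := covBy_iff_covIn.1 hxz
  have l1 : ∀ w ∈ R, w < x → w ≤ y := fun w hw h => hyx'.ge_of_not_twoDown hirr'.2 hw h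
  have l2 : ∀ w ∈ R, x < w → z ≤ w := fun w hw h => hxz'.le_of_not_twoUp hirr'.1 hw h
  refine ⟨y, not_not.1 (mt hk.isIrr_iff.2 hy), z, not_not.1 (mt hk.isIrr_iff.2 hz), hyx', hxz',
    l1, l2, ?_⟩
  -- The last vertex before `z` on a path avoiding `x` is the other side of the diamond; it is not
  -- `y`, since `x` prevents `z` from covering `y`.
  rcases Relation.TransGen.tail'_iff.1 hp with ⟨w, hyw, hwz, hwx, -⟩
  have hyw' : y ≤ w := by
    clear hwz hwx
    induction hyw with
    | refl => exact le_rfl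
    | tail _ h ih => exact ih.trans h.1.le
  have hyw'' : y < w := lt_of_le_of_ne hyw' (by
    rintro rfl
    exact hwz.2 hyx.lt hxz.lt)
  have hwx' : (w : L) ≠ x := fun h => hwx (Subtype.ext h)
  refine ⟨w, w.2, hyw'', hwz.lt, fun h => ?_, fun h => ?_⟩
  · exact (l1 w w.2 (lt_of_le_of_ne h hwx')).not_gt hyw''
  · exact (l2 w w.2 (lt_of_le_of_ne h (Ne.symm hwx'))).not_gt hwz.lt

end Retract

-- Height of a basic retract

section Height

variable {L : Type*} [Lattice L]

/-- The open interval between two consecutive elements of the chain `r` is not a chain. -/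
def Doubled (r : Fin 5 → L) (i : Fin 4) : Prop :=
  ∃ p q, p ∈ Set.Ioo (r i.castSucc) (r i.succ) ∧ q ∈ Set.Ioo (r i.castSucc) (r i.succ) ∧
    ¬ p ≤ q ∧ ¬ q ≤ p

noncomputable instance (r : Fin 5 → L) : DecidablePred (Doubled r) := fun _ => Classical.dec _

/-- The height of `r i` in a basic retract. -/
noncomputable def redHeight (r : Fin 5 → L) (i : Fin 5) : ℕ :=
  i + (Finset.univ.filter fun k : Fin 4 => k.castSucc < i ∧ Doubled r k).card

lemma redHeight_strictMono (r : Fin 5 → L) : StrictMono (redHeight r) := by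
  intro i j hij
  have : (Finset.univ.filter fun k : Fin 4 => k.castSucc < i ∧ Doubled r k).card ≤
      (Finset.univ.filter fun k : Fin 4 => k.castSucc < j ∧ Doubled r k).card := by
    apply Finset.card_le_card
    intro k
    simp only [Finset.mem_filter, Finset.mem_univ, true_and]
    exact fun h => ⟨h.1.trans hij, h.2⟩
  have h2 : (i : ℕ) < j := hij
  simp only [redHeight]
  omega

/-- Consecutive indices gain 1 from the index and 1 from the doubled interval; otherwise an
intermediate index already gives two steps. -/
lemma redHeight_add_two_le {r : Fin 5 → L} {i j : Fin 5} (hij : i < j)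
    (h : ∀ k : Fin 4, i = k.castSucc → j = k.succ → Doubled r k) :
    redHeight r i + 2 ≤ redHeight r j := by
  have h2 : (i : ℕ) < j := hij
  by_cases h3 : (j : ℕ) = i + 1
  · obtain ⟨k, rfl⟩ : ∃ k : Fin 4, k.castSucc = i := ⟨⟨i, by omega⟩, rfl⟩
    have hj : j = k.succ := Fin.ext (by simpa using h3)
    have hk := h k rfl hj
    have : (Finset.univ.filter fun l : Fin 4 => l.castSucc < k.castSucc ∧ Doubled r l).card <
        (Finset.univ.filter fun l : Fin 4 => l.castSucc < j ∧ Doubled r l).card := by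
      apply Finset.card_lt_card
      refine ⟨fun l => ?_, fun h' => ?_⟩
      · simp only [Finset.mem_filter, Finset.mem_univ, true_and]
        exact fun h => ⟨h.1.trans hij, h.2⟩
      · have := h' (x := k) (by simp [hij, hk])
        simp at this
    simp only [redHeight]
    omega
  · have h1 : i < j - 1 := by
      rw [Fin.lt_def]
      have : ((j - 1 : Fin 5) : ℕ) = j - 1 := by omega
      omega
    have h4 : j - 1 < j := by
      rw [Fin.lt_def]
      have : ((j - 1 : Fin 5) : ℕ) = j - 1 := by omega
      omega
    have := redHeight_strictMono r h1
    have := redHeight_strictMono r h4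
    omega

lemma redHeight_last (r : Fin 5 → L) :
    redHeight r (Fin.last 4) = 4 + (Finset.univ.filter fun k : Fin 4 => Doubled r k).card := by
  simp only [redHeight, Fin.castSucc_lt_last, true_and, Fin.val_last]

variable [Finite L]

/-- The height of a basic retract is bounded by the number of non-chain intervals. -/
lemma IsAssocBasicRetract.length_le (hL : IsBlock L) {r : Fin 5 → L} (hr : StrictMono r)
    (hred : Set.range r = red L) {R : Set L} (hR : IsAssocBasicRetract R) (s : LTSeries R) :
    s.length ≤ 4 + (Finset.univ.filter fun k : Fin 4 => Doubled r k).card := by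
  have hk := hR.keepsReducibility hL
  have hmem : ∀ i, r i ∈ R := fun i => hk.1 (hred ▸ ⟨i, rfl⟩)
  have hg := redHeight_strictMono r
  -- A rank function: an irreducible element between `r i` and `r j` is placed one above `r i`, and
  -- the diamond keeps it strictly below `r j`.
  have hex : ∀ x : R, ∃ (n : ℕ) (i j : Fin 5),
      ((x : L) = r i ∧ i = j ∧ n = redHeight r i) ∨
      ((x : L) ∉ red L ∧ (∀ w ∈ R, w < x → w ≤ r i) ∧ (∀ w ∈ R, x < w → r j ≤ w) ∧
        n = redHeight r i + 1 ∧ redHeight r i + 2 ≤ redHeight r j) := by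
    intro x
    by_cases hx : (x : L) ∈ red L
    · obtain ⟨i, hi⟩ : (x : L) ∈ Set.range r := hred ▸ hx
      exact ⟨_, i, i, Or.inl ⟨hi.symm, rfl, rfl⟩⟩
    · obtain ⟨y, hy, z, hz, hyx, hxz, h1, h2, w, hw, hyw, hwz, h3, h4⟩ :=
        hR.exists_diamond hL x.2 hx
      rw [← hred] at hy hz
      obtain ⟨i, rfl⟩ := hy
      obtain ⟨j, rfl⟩ := hz
      refine ⟨_, i, j, Or.inr ⟨hx, h1, h2, rfl, redHeight_add_two_le
        (hr.lt_iff_lt.1 (hyw.trans hwz)) ?_⟩⟩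
      rintro k rfl rfl
      exact ⟨w, x, ⟨hyw, hwz⟩, ⟨hyx.2.2.1, hxz.2.2.1⟩, h3, h4⟩
  choose n i j h using hex
  have hn : StrictMono n := by
    intro x y hxy
    have hxy' : (x : L) < y := hxy
    rcases h x with ⟨hx, hx1, hx2⟩ | ⟨hx, hx1, hx2, hx3, hx4⟩ <;>
      rcases h y with ⟨hy, hy1, hy2⟩ | ⟨hy, hy1, hy2, hy3, hy4⟩
    · rw [hx2, hy2]
      rw [hx, hy] at hxy'
      exact hg (hr.lt_iff_lt.1 hxy')
    · have := hg.monotone (hr.le_iff_le.1 (hx ▸ hy1 x x.2 hxy'))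
      omega
    · have := hg.monotone (hr.le_iff_le.1 (hy ▸ hx2 y y.2 hxy'))
      omega
    · have h1 := hx2 y y.2 hxy'
      have h2 : r (j x) < y := lt_of_le_of_ne h1 fun e => hy (by rw [← e, ← hred]; exact ⟨_, rfl⟩)
      have := hg.monotone (hr.le_iff_le.1 (hy1 _ (hmem _) h2))
      omega
  have hle : ∀ x, n x ≤ redHeight r (Fin.last 4) := by
    intro x
    rcases h x with ⟨hx, hx1, hx2⟩ | ⟨hx, hx1, hx2, hx3, hx4⟩
    · rw [hx2]; exact hg.monotone (Fin.le_last _)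
    · have := hg.monotone (Fin.le_last (j x))
      omega
  rw [← redHeight_last]
  refine le_trans ?_ (hle s.last)
  have h3 : ∀ m : ℕ, ∀ hm : m < s.length + 1, m ≤ n (s ⟨m, hm⟩) := by
    intro m
    induction m with
    | zero => intro _; exact Nat.zero_le _
    | succ m ih =>
      intro hm
      have h4 : n (s ⟨m, by omega⟩) < n (s ⟨m + 1, hm⟩) :=
        hn (s.strictMono (Fin.mk_lt_mk.2 (Nat.lt_succ_self m)))
      have := ih (by omega)
      omega
  exact h3 s.length (by omega)

end Height

-- Nullity of a block

section Nullity

variable {L : Type*} [Lattice L] [Finite L]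

lemma card_connectedComponent_hasse {t : L} (ht : IsTop t) :
    Nat.card (SimpleGraph.hasse L).ConnectedComponent = 1 := by
  have key : ∀ x : L, (SimpleGraph.hasse L).Reachable x t := by
    intro x
    induction x using WellFoundedGT.induction with
    | ind x ih =>
      rcases (ht x).eq_or_lt with rfl | h
      · exact SimpleGraph.Reachable.refl _
      · obtain ⟨c, hc, -⟩ := exists_covIn_le (Set.mem_univ x) (Set.mem_univ t) h
        have hc' := covIn_univ_iff.1 hc
        exact SimpleGraph.Reachable.trans
          (SimpleGraph.Adj.reachable (SimpleGraph.hasse_adj.2 (Or.inl hc'))) (ih c hc'.lt)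
  rw [Nat.card_eq_one_iff_unique]
  refine ⟨⟨fun a b => ?_⟩, ⟨(SimpleGraph.hasse L).connectedComponentMk t⟩⟩
  induction a using SimpleGraph.ConnectedComponent.ind with | _ a
  induction b using SimpleGraph.ConnectedComponent.ind with | _ b
  exact SimpleGraph.ConnectedComponent.sound ((key a).trans (key b).symm)

/-- Each edge is counted at its lower end. -/
lemma ncard_edgeSet_hasse [Fintype L] :
    (SimpleGraph.hasse L).edgeSet.ncard = ∑ x : L, {y | x ⋖ y}.ncard := by
  have h1 : ∑ x : L, {y | x ⋖ y}.ncard = Nat.card (Σ x : L, {y | x ⋖ y}) := by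
    rw [Nat.card_sigma]; rfl
  rw [h1, ← Nat.card_coe_set_eq]
  symm
  refine Nat.card_eq_of_bijective (fun p => ⟨s(p.1, p.2.1), ?_⟩) ⟨?_, ?_⟩
  · exact SimpleGraph.hasse_adj.2 (Or.inl p.2.2)
  · rintro ⟨x, y, hy⟩ ⟨x', y', hy'⟩ h
    have hy : x < y := CovBy.lt hy
    have hy' : x' < y' := CovBy.lt hy'
    rcases Sym2.eq_iff.1 (Subtype.mk.inj h) with ⟨rfl, rfl⟩ | ⟨rfl, rfl⟩
    · rfl
    · exact absurd hy hy'.asymm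
  · rintro ⟨e, he⟩
    induction e using Sym2.ind with | _ a b
    rcases SimpleGraph.hasse_adj.1 he with h | h
    · exact ⟨⟨a, b, h⟩, rfl⟩
    · exact ⟨⟨b, a, h⟩, Subtype.ext Sym2.eq_swap⟩

lemma ncard_covers_eq_one (hL : IsBlock L) {x : L} (hx : x ∉ red L) : {y | x ⋖ y}.ncard = 1 := by
  obtain ⟨-, ⟨t, ht, ht'⟩⟩ := hL
  have hxt : x < t := lt_of_le_of_ne (ht x) (by rintro rfl; exact hx ht')
  obtain ⟨c, hc, -⟩ := exists_covIn_le (Set.mem_univ x) (Set.mem_univ t) hxt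
  rw [Set.ncard_eq_one]
  refine ⟨c, Set.eq_singleton_iff_unique_mem.2 ⟨covIn_univ_iff.1 hc, fun d hd => ?_⟩⟩
  by_contra h
  exact hx (Or.inr (twoUp_univ_iff.1 ⟨d, c, h, covIn_univ_iff.2 hd, hc⟩))

/-- Only the reducible elements contribute to the nullity of a block. -/
lemma nullity_eq_sum (hL : IsBlock L) {r : Fin 5 → L} (hr : StrictMono r)
    (hred : Set.range r = red L) :
    nullity L = ∑ i : Fin 4, (({y | r i.castSucc ⋖ y}.ncard : ℤ) - 1) := by
  classical
  have := Fintype.ofFinite L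
  obtain ⟨t, ht, ht'⟩ := hL.2
  obtain ⟨k, rfl⟩ : t ∈ Set.range r := hred ▸ ht'
  obtain rfl : k = Fin.last 4 := le_antisymm (Fin.le_last _) (hr.le_iff_le.1 (ht _))
  rw [nullity, graphNullity, card_connectedComponent_hasse ht, ncard_edgeSet_hasse,
    Nat.card_eq_fintype_card, ← Finset.card_univ]
  have h1 : ((∑ x : L, {y | x ⋖ y}.ncard : ℕ) : ℤ) - (Finset.univ : Finset L).card =
      ∑ x : L, (({y | x ⋖ y}.ncard : ℤ) - 1) := by
    push_cast
    simp
  have h2 : ∑ x : L, (({y | x ⋖ y}.ncard : ℤ) - 1) =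
      ∑ x ∈ Finset.univ.image r, (({y | x ⋖ y}.ncard : ℤ) - 1) := by
    symm
    apply Finset.sum_subset (Finset.subset_univ _)
    intro x _ hx
    rw [ncard_covers_eq_one hL (fun h => hx (by rw [← hred] at h; simpa using h))]
    simp
  -- The top has no upper cover; its term -1 cancels the single connected component.
  have h3 : {y | r (Fin.last 4) ⋖ y} = ∅ := by
    ext y
    simp only [Set.mem_ofPred_eq, Set.mem_empty_iff_false, iff_false]
    exact fun h => (ht y).not_gt h.lt
  rw [h1, h2, Finset.sum_image hr.injective.injOn, Fin.sum_univ_castSucc, h3]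
  simp

end Nullity

-- Structure of the intervals between consecutive reducible elements

section Structure

/-- A finite chain in a partial order is enumerated by a strictly monotone map. -/
lemma exists_strictMono_enum {P : Type*} [PartialOrder P] [Finite P] {C : Set P} {n : ℕ}
    (hn : C.ncard = n) (hC : IsChain (· ≤ ·) C) :
    ∃ F : Fin n → P, StrictMono F ∧ Set.range F = C := by
  classical
  have := Fintype.ofFinite C
  let _ : LinearOrder C :=
    { (inferInstance : PartialOrder C) with
      le_total := fun a b => hC.total a.2 b.2
      toDecidableLE := Classical.decRel _
      toDecidableEq := Classical.decEq _
      toDecidableLT := Classical.decRel _ }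
  have hn' : Fintype.card C = n := by
    rw [← hn, ← Nat.card_coe_set_eq, Nat.card_eq_fintype_card]
  let e := Fintype.orderIsoFinOfCardEq C hn'
  refine ⟨fun k => (e k : P), fun a b hab => ?_, ?_⟩
  · exact e.strictMono hab
  · ext x
    constructor
    · rintro ⟨k, rfl⟩; exact (e k).2
    · intro hx
      exact ⟨e.symm ⟨x, hx⟩, by simp⟩

variable {L : Type*} [Lattice L] {r : Fin 5 → L}

/-- The recurring contradiction: meets and joins of incomparable elements are members of `r`, hence
never strictly inside an interval. -/
lemma not_between (hr : StrictMono r) {i : Fin 4} {k : Fin 5} (h1 : r i.castSucc < r k)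
    (h2 : r k < r i.succ) : False := by
  have h1 := hr.lt_iff_lt.1 h1
  have h2 := hr.lt_iff_lt.1 h2
  rw [Fin.lt_def] at h1 h2
  simp at h1 h2
  omega

lemma isMeetReducible_inf {p q : L} (h1 : ¬ p ≤ q) (h2 : ¬ q ≤ p) : IsMeetReducible (p ⊓ q) :=
  ⟨p, q, fun h => h1 (inf_eq_left.1 h.symm), fun h => h2 (inf_eq_right.1 h.symm), rfl⟩

lemma isJoinReducible_sup {p q : L} (h1 : ¬ p ≤ q) (h2 : ¬ q ≤ p) : IsJoinReducible (p ⊔ q) :=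
  ⟨p, q, fun h => h2 (sup_eq_left.1 h.symm), fun h => h1 (sup_eq_right.1 h.symm), rfl⟩

lemma inf_mem_range (hred : Set.range r = red L) {p q : L} (h1 : ¬ p ≤ q) (h2 : ¬ q ≤ p) :
    ∃ k, r k = p ⊓ q := by
  have : p ⊓ q ∈ red L := Or.inr (isMeetReducible_inf h1 h2)
  rwa [← hred] at this

lemma sup_mem_range (hred : Set.range r = red L) {p q : L} (h1 : ¬ p ≤ q) (h2 : ¬ q ≤ p) :
    ∃ k, r k = p ⊔ q := by
  have : p ⊔ q ∈ red L := Or.inl (isJoinReducible_sup h1 h2)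
  rwa [← hred] at this

lemma isBot_zero (hL : IsBlock L) (hr : StrictMono r) (hred : Set.range r = red L) :
    IsBot (r 0) := by
  obtain ⟨b, hb, hb'⟩ := hL.1
  obtain ⟨k, rfl⟩ : b ∈ Set.range r := hred ▸ hb'
  obtain rfl : k = 0 := le_antisymm (hr.le_iff_le.1 (hb _)) (Fin.zero_le _)
  exact hb

lemma isTop_last (hL : IsBlock L) (hr : StrictMono r) (hred : Set.range r = red L) :
    IsTop (r (Fin.last 4)) := by
  obtain ⟨b, hb, hb'⟩ := hL.2
  obtain ⟨k, rfl⟩ : b ∈ Set.range r := hred ▸ hb'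
  obtain rfl : k = Fin.last 4 := le_antisymm (Fin.le_last _) (hr.le_iff_le.1 (hb _))
  exact hb

/-- Every element is comparable with every member of the chain `r`. -/
def ComparableWith (r : Fin 5 → L) : Prop := ∀ x k, x ≤ r k ∨ r k ≤ x

/-- If one of two incomparable elements meeting in `r i` were above `r (i + 1)`, comparability would
put the other there too, and then also their meet. -/
lemma doubled_of_isMeetReducible (hr : StrictMono r) (hc : ComparableWith r) {i : Fin 4}
    (h : IsMeetReducible (r i.castSucc)) : Doubled r i := by
  obtain ⟨y, z, hy, hz, hyz⟩ := h
  have hlt := hr (Fin.castSucc_lt_succ (i := i))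
  have hy1 : r i.castSucc < y := lt_of_le_of_ne (hyz ▸ inf_le_left) (Ne.symm hy)
  have hz1 : r i.castSucc < z := lt_of_le_of_ne (hyz ▸ inf_le_right) (Ne.symm hz)
  have h1 : ¬ y ≤ z := fun h => hy (by rw [← hyz, inf_eq_left.2 h])
  have h2 : ¬ z ≤ y := fun h => hz (by rw [← hyz, inf_eq_right.2 h])
  have h3 : ¬ (r i.succ ≤ y ∧ r i.succ ≤ z) := fun h => (hyz ▸ le_inf h.1 h.2).not_gt hlt
  have hy2 : ¬ r i.succ ≤ y := fun h => (hc z i.succ).elim (fun h' => h2 (h'.trans h))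
    fun h' => h3 ⟨h, h'⟩
  have hz2 : ¬ r i.succ ≤ z := fun h => (hc y i.succ).elim (fun h' => h1 (h'.trans h))
    fun h' => h3 ⟨h', h⟩
  exact ⟨y, z, ⟨hy1, ((hc y i.succ).resolve_right hy2).lt_of_not_ge hy2⟩,
    ⟨hz1, ((hc z i.succ).resolve_right hz2).lt_of_not_ge hz2⟩, h1, h2⟩

lemma doubled_of_isJoinReducible (hr : StrictMono r) (hc : ComparableWith r) {i : Fin 4}
    (h : IsJoinReducible (r i.succ)) : Doubled r i := by
  obtain ⟨y, z, hy, hz, hyz⟩ := h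
  have hlt := hr (Fin.castSucc_lt_succ (i := i))
  have hy1 : y < r i.succ := lt_of_le_of_ne (hyz ▸ le_sup_left) hy
  have hz1 : z < r i.succ := lt_of_le_of_ne (hyz ▸ le_sup_right) hz
  have h1 : ¬ y ≤ z := fun h => hz (by rw [← hyz, sup_eq_right.2 h])
  have h2 : ¬ z ≤ y := fun h => hy (by rw [← hyz, sup_eq_left.2 h])
  have h3 : ¬ (y ≤ r i.castSucc ∧ z ≤ r i.castSucc) := fun h =>
    (hyz ▸ sup_le h.1 h.2).not_gt hlt
  have hy2 : ¬ y ≤ r i.castSucc := fun h => (hc z i.castSucc).elim (fun h' => h3 ⟨h, h'⟩)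
    fun h' => h1 (h.trans h')
  have hz2 : ¬ z ≤ r i.castSucc := fun h => (hc y i.castSucc).elim (fun h' => h3 ⟨h', h⟩)
    fun h' => h2 (h.trans h')
  exact ⟨y, z, ⟨((hc y i.castSucc).resolve_left hy2).lt_of_not_ge hy2, hy1⟩,
    ⟨((hc z i.castSucc).resolve_left hz2).lt_of_not_ge hz2, hz1⟩, h1, h2⟩

variable [Finite L]

/-- Two incomparable elements of the interval have meet exactly `r i`, so covers of `r i` below each
of them are distinct. -/
lemma Doubled.exists_covers (hr : StrictMono r) (hred : Set.range r = red L) {i : Fin 4}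
    (h : Doubled r i) : ∃ u v, u ≠ v ∧ r i.castSucc ⋖ u ∧ r i.castSucc ⋖ v ∧
      u < r i.succ ∧ v < r i.succ := by
  obtain ⟨p, q, hp, hq, h1, h2⟩ := h
  obtain ⟨k, hk⟩ := inf_mem_range hred h1 h2
  have h3 : r i.castSucc = p ⊓ q := (le_inf hp.1.le hq.1.le).eq_of_not_lt fun h =>
    not_between hr (hk ▸ h) (hk ▸ inf_le_left.trans_lt hp.2)
  obtain ⟨u, hu, hup⟩ := exists_covIn_le (Set.mem_univ (r i.castSucc)) (Set.mem_univ p) hp.1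
  obtain ⟨v, hv, hvq⟩ := exists_covIn_le (Set.mem_univ (r i.castSucc)) (Set.mem_univ q) hq.1
  refine ⟨u, v, ?_, covIn_univ_iff.1 hu, covIn_univ_iff.1 hv, hup.trans_lt hp.2,
    hvq.trans_lt hq.2⟩
  rintro rfl
  exact (h3 ▸ le_inf hup hvq).not_gt hu.2.2.1

lemma one_le_ncard_covers {x y : L} (h : x < y) : 1 ≤ {z | x ⋖ z}.ncard := by
  obtain ⟨c, hc, -⟩ := exists_covIn_le (Set.mem_univ x) (Set.mem_univ y) h
  exact (Set.ncard_pos (Set.toFinite _)).2 ⟨c, covIn_univ_iff.1 hc⟩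

lemma Doubled.two_le_ncard_covers (hr : StrictMono r) (hred : Set.range r = red L) {i : Fin 4}
    (h : Doubled r i) : 2 ≤ {z | r i.castSucc ⋖ z}.ncard := by
  obtain ⟨u, v, huv, hu, hv, -, -⟩ := h.exists_covers hr hred
  rw [← Set.ncard_pair huv]
  refine Set.ncard_le_ncard ?_ (Set.toFinite _)
  rintro _ (rfl | rfl) <;> assumption

/-- Nullity three and at least three non-chain intervals: the covers of the chain are as few as
possible. -/
lemma ncard_covers_eq (hL : IsBlock L) (hr : StrictMono r) (hred : Set.range r = red L)
    (hn : nullity L = 3) (hD : 3 ≤ (Finset.univ.filter fun k : Fin 4 => Doubled r k).card) :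
    (Finset.univ.filter fun k : Fin 4 => Doubled r k).card = 3 ∧
    ∀ i : Fin 4, {z | r i.castSucc ⋖ z}.ncard = if Doubled r i then 2 else 1 := by
  rw [nullity_eq_sum hL hr hred] at hn
  -- Each summand dominates the indicator of a doubled interval. With total 3 and at least three
  -- indicators, equality holds in every term.
  have h1 : ∀ i : Fin 4, (if Doubled r i then 1 else 0 : ℤ) ≤ {z | r i.castSucc ⋖ z}.ncard - 1 := by
    intro i
    split_ifs with h
    · have := h.two_le_ncard_covers hr hred
      omega
    · have := one_le_ncard_covers (hr (Fin.castSucc_lt_succ (i := i)))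
      omega
  have h2 : ∑ i : Fin 4, (if Doubled r i then 1 else 0 : ℤ) =
      (Finset.univ.filter fun k : Fin 4 => Doubled r k).card := by
    simp
  have h3 := Finset.sum_le_sum (s := Finset.univ) fun i _ => h1 i
  have h4 : ((Finset.univ.filter fun k : Fin 4 => Doubled r k).card : ℤ) = 3 := by omega
  have h5 := (Finset.sum_eq_sum_iff_of_le (s := Finset.univ) fun i _ => h1 i).1
    (by rw [h2, hn, h4])
  refine ⟨by omega, fun i => ?_⟩
  have := h5 i (Finset.mem_univ i)
  split_ifs at this ⊢ <;> omega

/-- The covers of `r i` are the two covers below `r (i + 1)`, or there is just one. -/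
lemma covers_le (hr : StrictMono r) (hred : Set.range r = red L) {i : Fin 4}
    (hi : {z | r i.castSucc ⋖ z}.ncard = if Doubled r i then 2 else 1) {c : L}
    (hc : r i.castSucc ⋖ c) : c ≤ r i.succ := by
  split_ifs at hi with h
  · obtain ⟨u, v, huv, hu, hv, hu', hv'⟩ := h.exists_covers hr hred
    have : {u, v} = {z | r i.castSucc ⋖ z} := by
      refine Set.eq_of_subset_of_ncard_le ?_ (by rw [hi, Set.ncard_pair huv]) (Set.toFinite _)
      rintro _ (rfl | rfl) <;> assumption
    have hc' : c ∈ ({u, v} : Set L) := this ▸ hc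
    rcases hc' with rfl | rfl
    · exact hu'.le
    · exact hv'.le
  · obtain ⟨d, hd, hdr⟩ := exists_covIn_le (Set.mem_univ (r i.castSucc)) (Set.mem_univ (r i.succ))
      (hr (Fin.castSucc_lt_succ (i := i)))
    obtain ⟨e, he⟩ := Set.ncard_eq_one.1 hi
    have h1 : c ∈ ({e} : Set L) := he ▸ hc
    have h2 : d ∈ ({e} : Set L) := he ▸ covIn_univ_iff.1 hd
    rw [Set.mem_singleton_iff] at h1 h2
    rw [h1, ← h2]; exact hdr

/-- If `x` lies above `r i` but is incomparable with `r (i + 1)`, a cover of `r i` below `x` also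
lies below `r (i + 1)`, so the meet of `x` and `r (i + 1)` is a reducible element strictly between.
-/
lemma comparableWith_of_ncard_covers (hL : IsBlock L) (hr : StrictMono r)
    (hred : Set.range r = red L)
    (hi : ∀ i : Fin 4, {z | r i.castSucc ⋖ z}.ncard = if Doubled r i then 2 else 1) :
    ComparableWith r := by
  intro x k
  induction k using Fin.induction with
  | zero => exact Or.inr (isBot_zero hL hr hred x)
  | succ i ih =>
    rcases ih with h | h
    · exact Or.inl (h.trans (hr (Fin.castSucc_lt_succ (i := i))).le)
    · rcases h.eq_or_lt with rfl | h
      · exact Or.inl (hr (Fin.castSucc_lt_succ (i := i))).le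
      · by_contra hcon
        rw [not_or] at hcon
        obtain ⟨c, hc, hcx⟩ := exists_covIn_le (Set.mem_univ (r i.castSucc)) (Set.mem_univ x) h
        have hc' := covers_le hr hred (hi i) (covIn_univ_iff.1 hc)
        obtain ⟨k, hk⟩ := inf_mem_range hred hcon.1 hcon.2
        refine not_between hr (k := k) (i := i) ?_ ?_
        · rw [hk]; exact hc.2.2.1.trans_le (le_inf hcx hc')
        · rw [hk]; exact lt_of_le_of_ne inf_le_right fun h => hcon.2 (inf_eq_right.1 h)

/-- The interval between two consecutive members of `r` is a disjoint union of at most two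
mutually incomparable chains. -/
lemma exists_two_chains (hr : StrictMono r) (hred : Set.range r = red L) {i : Fin 4}
    (hi : {z | r i.castSucc ⋖ z}.ncard = if Doubled r i then 2 else 1) :
    ∃ C : Bool → Set L, (C true).ncard ≤ (C false).ncard ∧ (∀ s, IsChain (· ≤ ·) (C s)) ∧
      (∀ s s', ∀ x ∈ C s, ∀ y ∈ C s', x ≤ y → s = s') ∧
      (∀ x, x ∈ Set.Ioo (r i.castSucc) (r i.succ) ↔ ∃ s, x ∈ C s) ∧
      (1 ≤ (C true).ncard ↔ Doubled r i) := by
  by_cases h : Doubled r i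
  · rw [if_pos h] at hi
    obtain ⟨u, v, huv, hu, hv, hu', hv'⟩ := h.exists_covers hr hred
    have heq : {u, v} = {z | r i.castSucc ⋖ z} := by
      refine Set.eq_of_subset_of_ncard_le ?_ (by rw [hi, Set.ncard_pair huv]) (Set.toFinite _)
      rintro _ (rfl | rfl) <;> assumption
    -- The label `false` is reserved for the longer chain.
    wlog hle : (Set.Ico v (r i.succ)).ncard ≤ (Set.Ico u (r i.succ)).ncard generalizing u v
    · exact this v u huv.symm hv hu hv' hu' (by rw [← heq, Set.pair_comm]) (not_le.1 hle).le
    have hchain : ∀ c, r i.castSucc ⋖ c → IsChain (· ≤ ·) (Set.Ico c (r i.succ)) := by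
      intro c hc x hx y hy _
      by_contra hcon
      rw [not_or] at hcon
      obtain ⟨k, hk⟩ := inf_mem_range hred hcon.1 hcon.2
      refine not_between hr (k := k) (i := i) ?_ ?_
      · rw [hk]; exact hc.lt.trans_le (le_inf hx.1 hy.1)
      · rw [hk]; exact inf_le_left.trans_lt hx.2
    -- Were the chains above `u` and `v` to share an element, `u ⊔ v` would be reducible and
    -- strictly inside the interval.
    have hcross : ∀ x, u ≤ x → v ≤ x → x < r i.succ → False := by
      intro x h1 h2 h3
      obtain ⟨k, hk⟩ := sup_mem_range hred (p := u) (q := v)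
        (fun h => huv ((hv.wcovBy.eq_or_eq hu.le h).resolve_left hu.ne'))
        (fun h => huv ((hu.wcovBy.eq_or_eq hv.le h).resolve_left hv.ne').symm)
      refine not_between hr (k := k) (i := i) ?_ ?_
      · rw [hk]; exact hu.lt.trans_le le_sup_left
      · rw [hk]; exact (sup_le h1 h2).trans_lt h3
    refine ⟨fun s => if s then Set.Ico v (r i.succ) else Set.Ico u (r i.succ), by simpa using hle,
      ?_, ?_, ?_, ?_⟩
    · rintro (_ | _)
      · simpa using hchain u hu
      · simpa using hchain v hv
    · rintro (_ | _) (_ | _) x hx y hy hxy <;> simp at hx hy ⊢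
      · exact hcross y (hx.1.trans hxy) hy.1 hy.2
      · exact hcross y hy.1 (hx.1.trans hxy) hy.2
    · intro x
      simp only [Bool.exists_bool, if_true, Bool.false_eq_true, if_false]
      constructor
      · rintro ⟨h1, h2⟩
        obtain ⟨c, hc, hcx⟩ := exists_covIn_le (Set.mem_univ (r i.castSucc)) (Set.mem_univ x) h1
        have hc' : c ∈ ({u, v} : Set L) := heq ▸ covIn_univ_iff.1 hc
        rcases hc' with rfl | rfl
        · exact Or.inl ⟨hcx, h2⟩
        · exact Or.inr ⟨hcx, h2⟩
      · rintro (h | h)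
        · exact ⟨hu.lt.trans_le h.1, h.2⟩
        · exact ⟨hv.lt.trans_le h.1, h.2⟩
    · simp only [if_true, h, iff_true]
      exact (Set.ncard_pos (Set.toFinite _)).2 ⟨v, le_rfl, hv'⟩
  · refine ⟨fun s => if s then ∅ else Set.Ioo (r i.castSucc) (r i.succ), by simp, ?_, ?_, ?_, ?_⟩
    · rintro (_ | _)
      · intro x hx y hy _
        by_contra hcon
        rw [not_or] at hcon
        exact h ⟨x, y, by simpa using hx, by simpa using hy, hcon.1, hcon.2⟩
      · simp
    · rintro (_ | _) (_ | _) x hx y hy hxy <;> simp at hx hy ⊢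
    · simp
    · simp [h]

end Structure

-- The model lattices

/-- Five nodes; between the nodes `i` and `i + 1` lie two chains with `n i false` and `n i true`
elements. -/
def Model (n : Fin 4 → Bool → ℕ) : Type := Fin 5 ⊕ (Σ q : Fin 4 × Bool, Fin (n q.1 q.2))

namespace Model

variable {n : Fin 4 → Bool → ℕ}

instance : Finite (Model n) := inferInstanceAs (Finite (_ ⊕ _))

/-- The nodes of the model. -/
def node (i : Fin 5) : Model n := Sum.inl i

/-- The elements on the chains of the model. -/
def bead (i : Fin 4) (s : Bool) (h : Fin (n i s)) : Model n := Sum.inr ⟨(i, s), h⟩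

lemma cases (x : Model n) : (∃ i, x = node i) ∨ ∃ i s h, x = bead i s h := by
  rcases x with i | ⟨⟨i, s⟩, h⟩
  · exact Or.inl ⟨i, rfl⟩
  · exact Or.inr ⟨i, s, h, rfl⟩

/-- The vertical position: even for nodes, odd for the chains between them. -/
def level : Model n → ℕ
  | Sum.inl i => 2 * i
  | Sum.inr ⟨q, _⟩ => 2 * q.1 + 1

/-- Distinguishes the two chains of a level. -/
def side : Model n → ℕ
  | Sum.inl _ => 0
  | Sum.inr ⟨q, _⟩ => q.2.toNat

/-- The position on a chain. -/
def ht : Model n → ℕ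
  | Sum.inl _ => 0
  | Sum.inr ⟨_, h⟩ => h

@[simp] lemma level_node (i : Fin 5) : level (node i : Model n) = 2 * i := rfl
@[simp] lemma side_node (i : Fin 5) : side (node i : Model n) = 0 := rfl
@[simp] lemma ht_node (i : Fin 5) : ht (node i : Model n) = 0 := rfl
@[simp] lemma level_bead (i s) (h : Fin (n i s)) : level (bead i s h) = 2 * i + 1 := rfl
@[simp] lemma side_bead (i s) (h : Fin (n i s)) : side (bead i s h) = s.toNat := rfl
@[simp] lemma ht_bead (i s) (h : Fin (n i s)) : ht (bead i s h) = h := rfl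

lemma ext_pos {x y : Model n} (h1 : level x = level y) (h2 : side x = side y)
    (h3 : ht x = ht y) : x = y := by
  rcases cases x with ⟨i, rfl⟩ | ⟨i, s, h, rfl⟩ <;> rcases cases y with ⟨j, rfl⟩ | ⟨j, t, k, rfl⟩ <;>
    simp only [level_node, level_bead, side_bead, ht_bead] at h1 h2 h3
  · congr 1; omega
  · omega
  · omega
  · obtain rfl : i = j := by omega
    obtain rfl : s = t := by revert h2; cases s <;> cases t <;> simp
    obtain rfl : h = k := Fin.ext h3
    rfl

/-- Natural-number coordinates reduce the order axioms to linear arithmetic. -/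
instance : PartialOrder (Model n) where
  le x y := level x < level y ∨ level x = level y ∧ side x = side y ∧ ht x ≤ ht y
  le_refl x := Or.inr ⟨rfl, rfl, le_rfl⟩
  le_trans x y z h1 h2 := by omega
  le_antisymm x y h1 h2 := ext_pos (by omega) (by omega) (by omega)

lemma le_def {x y : Model n} :
    x ≤ y ↔ level x < level y ∨ level x = level y ∧ side x = side y ∧ ht x ≤ ht y := Iff.rfl

lemma lt_def {x y : Model n} :
    x < y ↔ level x < level y ∨ level x = level y ∧ side x = side y ∧ ht x < ht y := by
  rw [lt_iff_le_not_ge, le_def, le_def]; omega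

lemma exists_of_incomparable {x y : Model n} (h1 : ¬ x ≤ y) (h2 : ¬ y ≤ x) :
    ∃ i : Fin 4, level x = 2 * i + 1 ∧ level y = 2 * i + 1 ∧ side x ≠ side y := by
  rw [le_def] at h1 h2
  rcases cases x with ⟨i, rfl⟩ | ⟨i, s, h, rfl⟩
  · rcases cases y with ⟨j, rfl⟩ | ⟨j, t, k, rfl⟩ <;> simp at h1 h2 <;> omega
  · exact ⟨i, rfl, by simp at h1 h2 ⊢; omega, by omega⟩

lemma node_le_of_level {i : Fin 5} {x : Model n} (h : 2 * (i : ℕ) ≤ level x) : node i ≤ x := by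
  rcases cases x with ⟨j, rfl⟩ | ⟨j, t, k, rfl⟩ <;> simp [le_def] at h ⊢ <;> omega

lemma le_node_of_level {i : Fin 5} {x : Model n} (h : level x ≤ 2 * (i : ℕ)) : x ≤ node i := by
  rcases cases x with ⟨j, rfl⟩ | ⟨j, t, k, rfl⟩ <;> simp [le_def] at h ⊢ <;> omega

lemma isLUB_of_incomparable {x y : Model n} {i : Fin 4} (hx : level x = 2 * i + 1)
    (hy : level y = 2 * i + 1) (h : side x ≠ side y) : IsLUB {x, y} (node i.succ) := by
  constructor
  · rintro z (rfl | rfl) <;> exact le_node_of_level (by simp; omega)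
  · intro z hz
    have h1 := hz (Set.mem_insert x _)
    have h2 := hz (Set.mem_insert_of_mem x (Set.mem_singleton y))
    rw [le_def] at h1 h2
    exact node_le_of_level (by simp; omega)

lemma isGLB_of_incomparable {x y : Model n} {i : Fin 4} (hx : level x = 2 * i + 1)
    (hy : level y = 2 * i + 1) (h : side x ≠ side y) : IsGLB {x, y} (node i.castSucc) := by
  constructor
  · rintro z (rfl | rfl) <;> exact node_le_of_level (by simp; omega)
  · intro z hz
    have h1 := hz (Set.mem_insert x _)
    have h2 := hz (Set.mem_insert_of_mem x (Set.mem_singleton y))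
    rw [le_def] at h1 h2
    exact le_node_of_level (by simp; omega)

lemma exists_isLUB (x y : Model n) : ∃ z, IsLUB {x, y} z := by
  by_cases h1 : x ≤ y
  · exact ⟨y, IsGreatest.isLUB ⟨Or.inr rfl, by rintro w (rfl | rfl); exacts [h1, le_rfl]⟩⟩
  by_cases h2 : y ≤ x
  · exact ⟨x, IsGreatest.isLUB ⟨Or.inl rfl, by rintro w (rfl | rfl); exacts [le_rfl, h2]⟩⟩
  obtain ⟨i, hx, hy, h⟩ := exists_of_incomparable h1 h2
  exact ⟨_, isLUB_of_incomparable hx hy h⟩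

lemma exists_isGLB (x y : Model n) : ∃ z, IsGLB {x, y} z := by
  by_cases h1 : x ≤ y
  · exact ⟨x, IsLeast.isGLB ⟨Or.inl rfl, by rintro w (rfl | rfl); exacts [le_rfl, h1]⟩⟩
  by_cases h2 : y ≤ x
  · exact ⟨y, IsLeast.isGLB ⟨Or.inr rfl, by rintro w (rfl | rfl); exacts [h2, le_rfl]⟩⟩
  obtain ⟨i, hx, hy, h⟩ := exists_of_incomparable h1 h2
  exact ⟨_, isGLB_of_incomparable hx hy h⟩

noncomputable instance : Lattice (Model n) where
  sup x y := (exists_isLUB x y).choose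
  inf x y := (exists_isGLB x y).choose
  le_sup_left x y := (exists_isLUB x y).choose_spec.1 (Set.mem_insert x _)
  le_sup_right x y := (exists_isLUB x y).choose_spec.1 (Set.mem_insert_of_mem x rfl)
  sup_le x y z h1 h2 := (exists_isLUB x y).choose_spec.2 (by rintro w (rfl | rfl) <;> assumption)
  inf_le_left x y := (exists_isGLB x y).choose_spec.1 (Set.mem_insert x _)
  inf_le_right x y := (exists_isGLB x y).choose_spec.1 (Set.mem_insert_of_mem x rfl)
  le_inf x y z h1 h2 := (exists_isGLB y z).choose_spec.2 (by rintro w (rfl | rfl) <;> assumption)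

lemma sup_of_incomparable {x y : Model n} {i : Fin 4} (hx : level x = 2 * i + 1)
    (hy : level y = 2 * i + 1) (h : side x ≠ side y) : x ⊔ y = node i.succ :=
  isLUB_pair.unique (isLUB_of_incomparable hx hy h)

lemma inf_of_incomparable {x y : Model n} {i : Fin 4} (hx : level x = 2 * i + 1)
    (hy : level y = 2 * i + 1) (h : side x ≠ side y) : x ⊓ y = node i.castSucc :=
  isGLB_pair.unique (isGLB_of_incomparable hx hy h)

lemma node_strictMono : StrictMono (node : Fin 5 → Model n) := by
  intro i j h
  rw [lt_def]; simp; omega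

lemma comparableWith_node : ComparableWith (node : Fin 5 → Model n) := by
  intro x k
  rcases le_total (level x) (2 * (k : ℕ)) with h | h
  · exact Or.inl (le_node_of_level h)
  · exact Or.inr (node_le_of_level h)

lemma mem_Ioo_iff {i : Fin 4} {x : Model n} :
    x ∈ Set.Ioo (node i.castSucc) (node i.succ) ↔ level x = 2 * i + 1 := by
  rw [Set.mem_Ioo, lt_def, lt_def]
  rcases cases x with ⟨j, rfl⟩ | ⟨j, t, k, rfl⟩ <;> simp <;> omega

lemma level_eq_iff {i : Fin 4} {x : Model n} :
    level x = 2 * i + 1 ↔ ∃ s h, x = bead i s h := by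
  constructor
  · intro h
    rcases cases x with ⟨j, rfl⟩ | ⟨j, t, k, rfl⟩
    · simp at h; omega
    · obtain rfl : j = i := by simp at h; omega
      exact ⟨t, k, rfl⟩
  · rintro ⟨s, h, rfl⟩; rfl

lemma card_eq : Nat.card (Model n) = 5 + ∑ i, (n i false + n i true) := by
  have : Nat.card (Model n) = Nat.card (Fin 5 ⊕ (Σ q : Fin 4 × Bool, Fin (n q.1 q.2))) := rfl
  rw [this]
  simp [Fintype.sum_prod_type, add_comm]

lemma doubled_node_iff {i : Fin 4} (hn : n i true ≤ n i false) :
    Doubled (node : Fin 5 → Model n) i ↔ 1 ≤ n i true := by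
  constructor
  · rintro ⟨p, q, hp, hq, h1, h2⟩
    rw [mem_Ioo_iff, level_eq_iff] at hp hq
    obtain ⟨s, h, rfl⟩ := hp
    obtain ⟨t, k, rfl⟩ := hq
    rw [le_def] at h1 h2
    simp at h1 h2
    have hst : s ≠ t := by rintro rfl; simp at h1 h2; omega
    cases s <;> cases t <;> simp at hst
    · have := k.2; omega
    · have := h.2; omega
  · intro h
    refine ⟨bead i false ⟨0, by omega⟩, bead i true ⟨0, by omega⟩, mem_Ioo_iff.2 rfl,
      mem_Ioo_iff.2 rfl, ?_, ?_⟩ <;> simp [le_def]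

/-- Two of the four intervals, the first and the last, and exactly one of the middle ones consist
of two chains; the longer chain is listed first. -/
def Admissible (n : Fin 4 → Bool → ℕ) : Prop :=
  (∀ i, n i true ≤ n i false) ∧ 1 ≤ n 0 true ∧ 1 ≤ n 3 true ∧
    ((1 ≤ n 1 true ∧ n 2 true = 0) ∨ (n 1 true = 0 ∧ 1 ≤ n 2 true))

lemma node_reducible_of_doubled {i : Fin 4} (h : Doubled (node : Fin 5 → Model n) i) :
    (node i.castSucc : Model n) ∈ red (Model n) ∧ (node i.succ : Model n) ∈ red (Model n) := by
  obtain ⟨p, q, hp, hq, h1, h2⟩ := h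
  obtain ⟨k, hk1, hk2, hk⟩ := exists_of_incomparable h1 h2
  rw [mem_Ioo_iff] at hp hq
  obtain rfl : k = i := by omega
  rw [← sup_of_incomparable hp hq hk, ← inf_of_incomparable hp hq hk]
  exact ⟨Or.inr (isMeetReducible_inf h1 h2), Or.inl (isJoinReducible_sup h1 h2)⟩

/-- Every node bounds a doubled interval, the middle node whichever of its two neighbours is
doubled. Conversely, incomparable elements join and meet in nodes. -/
lemma range_node (hn : Admissible n) : Set.range (node : Fin 5 → Model n) = red (Model n) := by
  obtain ⟨h0, h1, h2, h3⟩ := hn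
  apply Set.Subset.antisymm
  · have d : ∀ i : Fin 4, 1 ≤ n i true → _ := fun i hi =>
      node_reducible_of_doubled ((doubled_node_iff (h0 i)).2 hi)
    rintro _ ⟨k, rfl⟩
    fin_cases k
    · exact (d 0 h1).1
    · exact (d 0 h1).2
    · rcases h3 with h3 | h3
      · exact (d 1 h3.1).2
      · exact (d 2 h3.2).1
    · exact (d 3 h2).1
    · exact (d 3 h2).2
  · rintro _ (⟨y, z, hy, hz, rfl⟩ | ⟨y, z, hy, hz, rfl⟩)
    · obtain ⟨i, a, b, c⟩ := exists_of_incomparable (x := y) (y := z)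
        (fun h => hz (sup_eq_right.2 h).symm) (fun h => hy (sup_eq_left.2 h).symm)
      exact ⟨_, (sup_of_incomparable a b c).symm⟩
    · obtain ⟨i, a, b, c⟩ := exists_of_incomparable (x := y) (y := z)
        (fun h => hy (inf_eq_left.2 h).symm) (fun h => hz (inf_eq_right.2 h).symm)
      exact ⟨_, (inf_of_incomparable a b c).symm⟩

lemma isBlock (hn : Admissible n) : IsBlock (Model n) := by
  have h := range_node hn
  refine ⟨⟨node 0, fun x => node_le_of_level (by simp), ?_⟩,
    ⟨node (Fin.last 4), fun x => le_node_of_level ?_, ?_⟩⟩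
  · exact h.le ⟨0, rfl⟩
  · rcases cases x with ⟨j, rfl⟩ | ⟨j, t, k, rfl⟩ <;> simp <;> omega
  · exact h.le ⟨_, rfl⟩

lemma card_doubled (hn : Admissible n) :
    (Finset.univ.filter fun k : Fin 4 => Doubled (node : Fin 5 → Model n) k).card = 3 := by
  obtain ⟨h0, h1, h2, h3⟩ := hn
  rw [Finset.card_filter, Fin.sum_univ_four]
  simp only [doubled_node_iff (h0 _), h1, h2]
  rcases h3 with ⟨h3, h4⟩ | ⟨h3, h4⟩ <;> simp [h3, h4]

lemma ncard_covers_node (hn : Admissible n) (i : Fin 4) :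
    {z : Model n | node i.castSucc ⋖ z}.ncard =
      if Doubled (node : Fin 5 → Model n) i then 2 else 1 := by
  have hr := node_strictMono (n := n)
  have hred := range_node hn
  split_ifs with h
  · refine le_antisymm ?_ (h.two_le_ncard_covers hr hred)
    have h1 := (doubled_node_iff (hn.1 i)).1 h
    have h2 := hn.1 i
    refine (Set.ncard_le_ncard (t := {bead i false ⟨0, by omega⟩, bead i true ⟨0, by omega⟩}) ?_
      (Set.toFinite _)).trans ((Set.ncard_insert_le _ _).trans (by simp))
    intro z hz
    have hlt : 2 * (i : ℕ) < level z := by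
      have := hz.lt
      rw [lt_def] at this
      rcases cases z with ⟨j, rfl⟩ | ⟨j, t, k, rfl⟩ <;> simp at this ⊢ <;> omega
    by_cases hl : level z = 2 * i + 1
    · obtain ⟨s, ⟨k, hk⟩, rfl⟩ := level_eq_iff.1 hl
      obtain rfl : k = 0 := by
        by_contra hk0
        refine hz.2 (c := bead i s ⟨0, by omega⟩) ?_ ?_ <;> rw [lt_def] <;> simp
        omega
      cases s
      · exact Or.inl rfl
      · exact Or.inr rfl
    · exfalso
      refine hz.2 (c := bead i true ⟨0, by omega⟩) ?_ ?_ <;> rw [lt_def] <;> simp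
      omega
  · refine le_antisymm ?_ (one_le_ncard_covers (hr (Fin.castSucc_lt_succ (i := i))))
    rw [Set.ncard_le_one (Set.toFinite _)]
    intro u hu v hv
    by_contra huv
    exact h (doubled_of_isMeetReducible hr comparableWith_node
      (twoUp_univ_iff.1 ⟨u, v, huv, covIn_univ_iff.2 hu, covIn_univ_iff.2 hv⟩))

lemma nullity_eq (hn : Admissible n) : nullity (Model n) = 3 := by
  rw [nullity_eq_sum (isBlock hn) node_strictMono (range_node hn)]
  simp only [ncard_covers_node hn]
  have := card_doubled hn
  rw [Finset.card_filter] at this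
  rw [← Nat.cast_inj (R := ℤ)] at this
  push_cast at this
  rw [← this]
  refine Finset.sum_congr rfl fun i _ => ?_
  split_ifs <;> simp

end Model

-- Height and class membership of the models

/-- A basic retract contains an element of every interval that is not a chain. -/
lemma IsAssocBasicRetract.exists_mem_Ioo {L : Type*} [Lattice L] [Finite L] (hL : IsBlock L)
    {r : Fin 5 → L} (hr : StrictMono r) (hred : Set.range r = red L) (hc : ComparableWith r)
    {R : Set L} (hR : IsAssocBasicRetract R) {i : Fin 4} (h : Doubled r i) :
    ∃ m ∈ R, r i.castSucc < m ∧ m < r i.succ := by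
  have hk := hR.keepsReducibility hL
  have hmem : ∀ i, r i ∈ R := fun i => hk.1 (hred ▸ ⟨i, rfl⟩)
  have hlt := hr (Fin.castSucc_lt_succ (i := i))
  obtain ⟨u, v, huv, hu, hv, -, -⟩ := h.exists_covers hr hred
  obtain ⟨u', v', huv', hu', hv'⟩ := (hk.2 _ (hmem i.castSucc)).1.2
    (twoUp_univ_iff.1 ⟨u, v, huv, covIn_univ_iff.2 hu, covIn_univ_iff.2 hv⟩)
  by_contra hcon
  -- If `R` missed the interval, `r (i + 1)` would be the only upper cover of `r i` in `R`, although
  -- `r i` is still meet-reducible.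
  have key : ∀ w, CovIn R (r i.castSucc) w → r i.succ = w := fun w hw => by
    refine hw.eq_of_le (hmem _) hlt ((hc w i.succ).elim (fun h' => ?_) id)
    exact (h'.eq_of_not_lt fun h'' => hcon ⟨w, hw.2.1, hw.2.2.1, h''⟩).ge
  exact huv' ((key _ hu').symm.trans (key _ hv'))

namespace Model

variable {n : Fin 4 → Bool → ℕ}

/-- The five nodes and one element of each doubled interval form a chain of eight elements. -/
lemma exists_ltSeries (hn : Admissible n) {R : Set (Model n)} (hR : IsAssocBasicRetract R) :
    ∃ s : LTSeries R, s.length = 7 := by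
  have hL := isBlock hn
  have hr := node_strictMono (n := n)
  have hred := range_node hn
  have hk := hR.keepsReducibility hL
  have hmem : ∀ i, node i ∈ R := fun i => hk.1 (hred ▸ ⟨i, rfl⟩)
  have hex : ∀ i : Fin 4, 1 ≤ n i true → _ := fun i hi =>
    hR.exists_mem_Ioo hL hr hred comparableWith_node ((doubled_node_iff (hn.1 i)).2 hi)
  obtain ⟨-, h0, h3, h⟩ := hn
  obtain ⟨m0, hm0, a0, b0⟩ := hex 0 h0
  obtain ⟨m3, hm3, a3, b3⟩ := hex 3 h3
  let q : Fin 5 → R := fun i => ⟨node i, hmem i⟩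
  rcases h with ⟨h, -⟩ | ⟨-, h⟩
  · obtain ⟨m1, hm1, a1, b1⟩ := hex 1 h
    refine ⟨⟨7, ![q 0, ⟨m0, hm0⟩, q 1, ⟨m1, hm1⟩, q 2, q 3, ⟨m3, hm3⟩, q 4], ?_⟩, rfl⟩
    intro i
    fin_cases i
    exacts [a0, b0, a1, b1, hr (a := 2) (b := 3) (by decide), a3, b3]
  · obtain ⟨m2, hm2, a2, b2⟩ := hex 2 h
    refine ⟨⟨7, ![q 0, ⟨m0, hm0⟩, q 1, q 2, ⟨m2, hm2⟩, q 3, ⟨m3, hm3⟩, q 4], ?_⟩, rfl⟩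
    intro i
    fin_cases i
    exacts [a0, b0, hr (a := 1) (b := 2) (by decide), a2, b2, a3, b3]

lemma krullDim_eq (hn : Admissible n) {R : Set (Model n)} (hR : IsAssocBasicRetract R) :
    Order.krullDim R = (7 : ℕ) := by
  apply le_antisymm
  · refine iSup_le fun s => ?_
    have := hR.length_le (isBlock hn) node_strictMono (range_node hn) s
    rw [card_doubled hn] at this
    exact_mod_cast this
  · obtain ⟨s, hs⟩ := exists_ltSeries hn hR
    rw [← hs]
    exact Order.LTSeries.length_le_krullDim s

/-- The model as a finite lattice. -/
noncomputable def toFiniteLattice (n : Fin 4 → Bool → ℕ) {j : ℕ}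
    (hj : 5 + ∑ i, (n i false + n i true) = j) : FiniteLattice j where
  carrier := Model n
  card_eq := card_eq.trans hj

lemma memB_toFiniteLattice (hn : Admissible n) {j : ℕ}
    (hj : 5 + ∑ i, (n i false + n i true) = j) : MemB j 5 3 7 (toFiniteLattice n hj) := by
  have hL := isBlock hn
  refine ⟨hL, ?_, ?_, nullity_eq hn, ?_⟩
  · change (red (Model n)).ncard = 5
    rw [← range_node hn, ← Set.image_univ, Set.ncard_image_of_injective _ node_strictMono.injective]
    simp
  · change IsChain (· ≤ ·) (red (Model n))
    rw [← range_node hn]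
    rintro _ ⟨k, rfl⟩ _ ⟨l, rfl⟩ -
    exact comparableWith_node _ _
  · obtain ⟨R, hR⟩ := exists_isAssocBasicRetract (Model n)
    exact ⟨R, (isAssocBasicBlock_iff hL).2 hR, krullDim_eq hn hR⟩

end Model

-- Every member of the class is a model

section Classification

variable {L : Type*} [Lattice L] {r : Fin 5 → L}

lemma exists_eq_or_mem_Ioo (hL : IsBlock L) (hr : StrictMono r) (hred : Set.range r = red L)
    (hc : ComparableWith r) (x : L) :
    (∃ k, x = r k) ∨ ∃ i : Fin 4, x ∈ Set.Ioo (r i.castSucc) (r i.succ) := by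
  have key : ∀ k, x ≤ r k → (∃ k, x = r k) ∨
      ∃ i : Fin 4, x ∈ Set.Ioo (r i.castSucc) (r i.succ) := by
    intro k
    induction k using Fin.induction with
    | zero => exact fun h => Or.inl ⟨0, le_antisymm h (isBot_zero hL hr hred x)⟩
    | succ i ih =>
      intro h
      rcases hc x i.castSucc with h' | h'
      · exact ih h'
      · rcases h'.eq_or_lt with e | h1
        · exact Or.inl ⟨_, e.symm⟩
        · rcases h.eq_or_lt with e | h2
          · exact Or.inl ⟨_, e⟩
          · exact Or.inr ⟨i, h1, h2⟩
  exact key _ (isTop_last hL hr hred x)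

variable [Finite L]

/-- A lattice whose intervals between consecutive reducible elements split into at most two chains
is a model. -/
lemma exists_orderIso_model (hL : IsBlock L) (hr : StrictMono r) (hred : Set.range r = red L)
    (hi : ∀ i : Fin 4, {z | r i.castSucc ⋖ z}.ncard = if Doubled r i then 2 else 1) :
    ∃ n : Fin 4 → Bool → ℕ, Nonempty (Model n ≃o L) ∧
      ∀ i, n i true ≤ n i false ∧ (1 ≤ n i true ↔ Doubled r i) := by
  have hc := comparableWith_of_ncard_covers hL hr hred hi
  choose C hC1 hC2 hC3 hC4 hC5 using fun i => exists_two_chains hr hred (hi i)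
  choose F hF1 hF2 using fun i s => exists_strictMono_enum rfl (hC2 i s)
  have hmem : ∀ i s h, F i s h ∈ C i s := fun i s h => hF2 i s ▸ ⟨h, rfl⟩
  have hIoo : ∀ i s h, F i s h ∈ Set.Ioo (r i.castSucc) (r i.succ) := fun i s h =>
    (hC4 i _).2 ⟨s, hmem i s h⟩
  refine ⟨fun i s => (C i s).ncard, ?_, fun i => ⟨hC1 i, hC5 i⟩⟩
  let φ : Model (fun i s => (C i s).ncard) → L := Sum.elim r fun p => F p.1.1 p.1.2 p.2
  have φn : ∀ i, φ (Model.node i) = r i := fun _ => rfl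
  have φb : ∀ i s h, φ (Model.bead i s h) = F i s h := fun _ _ _ => rfl
  -- Different levels are separated by a member of `r`; equal levels reduce to the chain
  -- enumerations.
  have h1 : ∀ x y, Model.level x < Model.level y → φ x < φ y := by
    intro x y hxy
    rcases Model.cases x with ⟨i, rfl⟩ | ⟨i, s, h, rfl⟩ <;>
      rcases Model.cases y with ⟨j, rfl⟩ | ⟨j, t, k, rfl⟩ <;>
      simp only [Model.level_node, Model.level_bead, φn, φb] at hxy ⊢
    · exact hr (by rw [Fin.lt_def]; omega)
    · exact (hr.monotone (by rw [Fin.le_def, Fin.val_castSucc]; omega)).trans_lt (hIoo j t k).1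
    · exact (hIoo i s h).2.trans_le (hr.monotone (by rw [Fin.le_def, Fin.val_succ]; omega))
    · exact ((hIoo i s h).2.trans_le (hr.monotone
        (by rw [Fin.le_def, Fin.val_succ, Fin.val_castSucc]; omega))).trans (hIoo j t k).1
  have h2 : ∀ x y, φ x ≤ φ y ↔ x ≤ y := by
    intro x y
    rcases lt_trichotomy (Model.level x) (Model.level y) with h | h | h
    · exact iff_of_true (h1 x y h).le (Or.inl h)
    · rcases Model.cases x with ⟨i, rfl⟩ | ⟨i, s, a, rfl⟩ <;>
        rcases Model.cases y with ⟨j, rfl⟩ | ⟨j, t, b, rfl⟩ <;>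
        simp only [Model.level_node, Model.level_bead] at h
      · obtain rfl : i = j := by omega
        simp
      · omega
      · omega
      · obtain rfl : i = j := by omega
        rw [φb, φb, Model.le_def]
        simp only [Model.level_bead, lt_self_iff_false, true_and, false_or, Model.side_bead,
          Model.ht_bead]
        constructor
        · intro hab
          obtain rfl := hC3 i s t _ (hmem i s a) _ (hmem i t b) hab
          exact ⟨rfl, (hF1 i s).le_iff_le.1 hab⟩
        · rintro ⟨hst, hab⟩
          obtain rfl : s = t := by revert hst; cases s <;> cases t <;> simp
          exact (hF1 i s).monotone hab
    · refine iff_of_false (h1 y x h).not_ge ?_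
      rw [Model.le_def]; omega
  have h3 : Function.Surjective φ := by
    intro x
    rcases exists_eq_or_mem_Ioo hL hr hred hc x with ⟨k, rfl⟩ | ⟨i, hx⟩
    · exact ⟨Model.node k, rfl⟩
    · obtain ⟨s, hs⟩ := (hC4 i x).1 hx
      rw [← hF2 i s] at hs
      obtain ⟨h, rfl⟩ := hs
      exact ⟨Model.bead i s h, rfl⟩
  exact ⟨RelIso.ofSurjective (OrderEmbedding.ofMapLEIff φ h2) h3⟩

/-- Every member of the class is isomorphic to a model. -/
lemma exists_model_of_memB {j : ℕ} {M : FiniteLattice j} (hM : MemB j 5 3 7 M) :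
    ∃ n : Fin 4 → Bool → ℕ, Nonempty (Model n ≃o M.carrier) ∧ Model.Admissible n ∧
      5 + ∑ i, (n i false + n i true) = j := by
  obtain ⟨hL, hcard, hchain, hnull, B, hB, hdim⟩ := hM
  obtain ⟨r, hr, hred⟩ := exists_strictMono_enum hcard hchain
  rw [isAssocBasicBlock_iff hL] at hB
  obtain ⟨s, hs⟩ := Order.le_krullDim_iff.1 hdim.ge
  have hlen := hB.length_le hL hr hred s
  obtain ⟨hD, hi⟩ := ncard_covers_eq hL hr hred hnull (by omega)
  have hc := comparableWith_of_ncard_covers hL hr hred hi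
  obtain ⟨n, ⟨e⟩, hn⟩ := exists_orderIso_model hL hr hred hi
  refine ⟨n, ⟨e⟩, ?_, ?_⟩
  -- The bottom is not a join of other elements, so it is meet-reducible; dually for the top.
  · have h0 : Doubled r 0 := by
      refine doubled_of_isMeetReducible hr hc ?_
      have : r 0 ∈ red M.carrier := hred ▸ ⟨0, rfl⟩
      refine this.resolve_left ?_
      rintro ⟨y, z, hy, -, hyz⟩
      exact hy (le_antisymm (hyz ▸ le_sup_left) (isBot_zero hL hr hred y))
    have h3 : Doubled r 3 := by
      refine doubled_of_isJoinReducible hr hc ?_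
      have : r (Fin.last 4) ∈ red M.carrier := hred ▸ ⟨_, rfl⟩
      refine this.resolve_right ?_
      rintro ⟨y, z, hy, -, hyz⟩
      exact hy (le_antisymm (isTop_last hL hr hred y) (hyz ▸ inf_le_left))
    have h0' := (hn 0).2.2 h0
    have h3' := (hn 3).2.2 h3
    refine ⟨fun i => (hn i).1, h0', h3', ?_⟩
    rw [Finset.card_filter, Fin.sum_univ_four, if_pos h0, if_pos h3] at hD
    have h1 := (hn 1).2
    have h2 := (hn 2).2
    by_cases d1 : Doubled r 1 <;> by_cases d2 : Doubled r 2 <;> simp [d1, d2] at hD h1 h2 <;> omega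
  · rw [← Model.card_eq, Nat.card_congr e.toEquiv, M.card_eq]

end Classification

-- Isomorphism invariance of the chain lengths

lemma IsReducible.map_orderIso {α β : Type*} [Lattice α] [Lattice β] {x : α}
    (h : IsReducible x) (e : α ≃o β) : IsReducible (e x) := by
  rcases h with ⟨y, z, hy, hz, rfl⟩ | ⟨y, z, hy, hz, rfl⟩
  · exact Or.inl ⟨e y, e z, e.injective.ne hy, e.injective.ne hz, (e.map_sup y z).symm⟩
  · exact Or.inr ⟨e y, e z, e.injective.ne hy, e.injective.ne hz, (e.map_inf y z).symm⟩

namespace Model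

variable {n m : Fin 4 → Bool → ℕ}

/-- Isomorphisms preserve reducible elements, and a strictly increasing enumeration is determined by
its range. -/
lemma orderIso_node (hn : Admissible n) (hm : Admissible m) (e : Model n ≃o Model m) (i : Fin 5) :
    e (node i) = node i := by
  have h1 : StrictMono fun i => e (node i) := e.strictMono.comp node_strictMono
  have h2 : Set.range (fun i => e (node i)) = Set.range (node : Fin 5 → Model m) := by
    rw [range_node hm]
    have hn' := range_node hn
    ext x
    constructor
    · rintro ⟨k, rfl⟩
      exact IsReducible.map_orderIso (hn'.le ⟨k, rfl⟩) e
    · intro hx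
      obtain ⟨k, hk⟩ := hn'.ge (IsReducible.map_orderIso hx e.symm)
      exact ⟨k, by simp [hk]⟩
  exact congrFun ((h1.range_inj node_strictMono).1 h2) i

lemma orderIso_level (hn : Admissible n) (hm : Admissible m) (e : Model n ≃o Model m) {i : Fin 4}
    {x : Model n} : level (e x) = 2 * i + 1 ↔ level x = 2 * i + 1 := by
  rw [← mem_Ioo_iff, ← mem_Ioo_iff, Set.mem_Ioo, Set.mem_Ioo, ← orderIso_node hn hm e,
    ← orderIso_node hn hm e, e.lt_iff_lt, e.lt_iff_lt]

lemma bead_injective (i : Fin 4) (s : Bool) :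
    Function.Injective (bead i s : Fin (n i s) → Model n) := by
  intro a b h
  exact Fin.ext (congrArg ht h)

lemma ncard_range_bead (i : Fin 4) (s : Bool) :
    (Set.range (bead i s : Fin (n i s) → Model n)).ncard = n i s := by
  rw [Set.ncard_range_of_injective (bead_injective i s)]
  simp

lemma ncard_level (i : Fin 4) :
    {x : Model n | level x = 2 * i + 1}.ncard = n i false + n i true := by
  have : {x : Model n | level x = 2 * i + 1} =
      Set.range (bead i false) ∪ Set.range (bead i true) := by
    ext x
    rw [Set.mem_ofPred_eq, level_eq_iff, Bool.exists_bool]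
    simp only [Set.mem_union, Set.mem_range, eq_comm]
  rw [this, Set.ncard_union_eq _ (Set.toFinite _) (Set.toFinite _), ncard_range_bead,
    ncard_range_bead]
  rw [Set.disjoint_left]
  rintro _ ⟨a, rfl⟩ ⟨b, h⟩
  have := congrArg side h
  simp at this

/-- Expresses a chain length through the order alone, up to the level, which isomorphisms preserve.
-/
lemma ncard_comparable (i : Fin 4) (s : Bool) (h : Fin (n i s)) :
    {x : Model n | level x = 2 * i + 1 ∧ (x ≤ bead i s h ∨ bead i s h ≤ x)}.ncard = n i s := by
  convert ncard_range_bead (n := n) i s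
  ext x
  constructor
  · rintro ⟨h1, h2⟩
    obtain ⟨t, k, rfl⟩ := level_eq_iff.1 h1
    obtain rfl : s = t := by
      rw [le_def, le_def] at h2
      revert h2; cases s <;> cases t <;> simp
    exact ⟨k, rfl⟩
  · rintro ⟨k, rfl⟩
    refine ⟨rfl, ?_⟩
    rw [le_def, le_def]
    simp
    omega

/-- The longer chain is carried onto one of the two chains of the same level, neither of which
exceeds `m i false`. -/
lemma false_le_of_orderIso (hn : Admissible n) (hm : Admissible m) (e : Model n ≃o Model m)
    (i : Fin 4) : n i false ≤ m i false := by
  rcases Nat.eq_zero_or_pos (n i false) with h | h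
  · omega
  have hlev : level (e (bead i false ⟨0, h⟩)) = 2 * i + 1 := (orderIso_level hn hm e).2 rfl
  obtain ⟨s, k, hk⟩ := level_eq_iff.1 hlev
  have h1 := ncard_comparable i false (⟨0, h⟩ : Fin (n i false))
  have h2 := ncard_comparable i s k
  rw [← hk] at h2
  have h3 : n i false = m i s := by
    rw [← h1, ← h2, ← Set.ncard_image_of_injective _ e.injective]
    congr 1
    ext x
    constructor
    · rintro ⟨y, ⟨hy, hy'⟩, rfl⟩
      exact ⟨(orderIso_level hn hm e).2 hy, by simpa using hy'⟩
    · rintro ⟨hx, hx'⟩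
      obtain ⟨y, rfl⟩ := e.surjective x
      exact ⟨y, ⟨(orderIso_level hn hm e).1 hx, by simpa using hx'⟩, rfl⟩
  have h4 := hm.1 i
  cases s <;> omega

/-- Isomorphic models have the same chain sizes. -/
lemma eq_of_orderIso (hn : Admissible n) (hm : Admissible m) (e : Model n ≃o Model m) : n = m := by
  have h1 : ∀ i, n i false = m i false := fun i =>
    le_antisymm (false_le_of_orderIso hn hm e i) (false_le_of_orderIso hm hn e.symm i)
  have h2 : ∀ i, n i false + n i true = m i false + m i true := by
    intro i
    rw [← ncard_level, ← ncard_level, ← Set.ncard_image_of_injective _ e.injective]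
    congr 1
    ext x
    constructor
    · rintro ⟨y, hy, rfl⟩
      exact (orderIso_level hn hm e).2 hy
    · intro hx
      obtain ⟨y, rfl⟩ := e.surjective x
      exact ⟨y, (orderIso_level hn hm e).1 hx, rfl⟩
  funext i s
  have := h1 i
  have := h2 i
  cases s <;> omega

end Model

-- Counting the admissible chain lengths

section Counting

/-- A partition into two parts is determined by its smaller part `b`, with `1 ≤ b ≤ n / 2`. -/
lemma numPartitions_two (n : ℕ) : numPartitions n 2 = n / 2 := by
  rw [numPartitions]
  have : n / 2 = (Finset.Icc 1 (n / 2)).card := by simp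
  rw [this]
  symm
  refine Finset.card_bij (fun b hb => ⟨{n - b, b}, ?_, ?_⟩) ?_ ?_ ?_
  · intro i hi
    rw [Finset.mem_Icc] at hb
    simp at hi
    omega
  · rw [Finset.mem_Icc] at hb
    simp; omega
  · intro b hb
    simp
  · intro b hb b' hb' h
    rw [Finset.mem_Icc] at hb hb'
    have h' : ({n - b, b} : Multiset ℕ) = {n - b', b'} := congrArg Nat.Partition.parts h
    have h1 : b ∈ ({n - b', b'} : Multiset ℕ) := h' ▸ by simp
    simp at h1
    omega
  · intro p hp
    simp only [Finset.mem_filter, Finset.mem_univ, true_and] at hp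
    obtain ⟨x, y, hxy⟩ := Multiset.card_eq_two.1 hp
    have hs := p.parts_sum
    have hx := p.parts_pos (i := x) (by simp [hxy])
    have hy := p.parts_pos (i := y) (by simp [hxy])
    rw [hxy] at hs
    simp at hs
    rcases le_total x y with h | h
    · refine ⟨x, by rw [Finset.mem_Icc]; omega, Nat.Partition.ext ?_⟩
      rw [hxy, Multiset.pair_comm x y]
      simp; omega
    · refine ⟨y, by rw [Finset.mem_Icc]; omega, Nat.Partition.ext ?_⟩
      rw [hxy]
      simp; omega

/-- The parameters counted by the triple sum. -/
def params (j : ℕ) : Finset (Σ _ : ℕ, Σ _ : ℕ, Σ _ : ℕ, Bool × ℕ × ℕ × ℕ) :=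
  (Finset.Icc 4 (j - 7)).sigma fun u => (Finset.Icc 0 (u - 4)).sigma fun r =>
    (Finset.Icc 4 (j - u - 3)).sigma fun l =>
      Finset.univ ×ˢ Finset.Icc 1 ((u - r - 2) / 2) ×ˢ Finset.Icc 1 ((l - 2) / 2) ×ˢ
        Finset.Icc 1 ((j - u - l - 1) / 2)

lemma card_params (j : ℕ) : (params j).card =
    ∑ u ∈ Finset.Icc 4 (j - 7), ∑ r ∈ Finset.Icc 0 (u - 4), ∑ l ∈ Finset.Icc 4 (j - u - 3),
      2 * numPartitions (u - r - 2) 2 * numPartitions (l - 2) 2 *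
        numPartitions (j - u - l - 1) 2 := by
  simp only [params, Finset.card_sigma, Finset.card_product, numPartitions_two, Nat.card_Icc,
    Finset.card_univ, Fintype.card_bool, Nat.add_sub_cancel, mul_assoc]

/-- The chain sizes `a`, `b` of an interval. -/
def pairSizes (a b : ℕ) : Bool → ℕ
  | false => a
  | true => b

/-- The chain sizes encoded by a parameter. -/
def sizes (j : ℕ) : (Σ _ : ℕ, Σ _ : ℕ, Σ _ : ℕ, Bool × ℕ × ℕ × ℕ) → Fin 4 → Bool → ℕ
  -- The Boolean says which middle interval is the single chain of `r` elements; each `b` is the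
  -- length of a shorter chain.
  | ⟨u, r, l, false, b₁, b₂, b₃⟩ => ![pairSizes (u - r - 2 - b₁) b₁, pairSizes (l - 2 - b₂) b₂,
      pairSizes r 0, pairSizes (j - u - l - 1 - b₃) b₃]
  | ⟨u, r, l, true, b₁, b₂, b₃⟩ => ![pairSizes (u - r - 2 - b₁) b₁, pairSizes r 0,
      pairSizes (l - 2 - b₂) b₂, pairSizes (j - u - l - 1 - b₃) b₃]

lemma mem_params {j u r l : ℕ} {c : Bool} {b₁ b₂ b₃ : ℕ} :
    (⟨u, r, l, c, b₁, b₂, b₃⟩ : Σ _ : ℕ, Σ _ : ℕ, Σ _ : ℕ, Bool × ℕ × ℕ × ℕ) ∈ params j ↔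
      (4 ≤ u ∧ u ≤ j - 7) ∧ r ≤ u - 4 ∧ (4 ≤ l ∧ l ≤ j - u - 3) ∧
      (1 ≤ b₁ ∧ b₁ ≤ (u - r - 2) / 2) ∧ (1 ≤ b₂ ∧ b₂ ≤ (l - 2) / 2) ∧
      (1 ≤ b₃ ∧ b₃ ≤ (j - u - l - 1) / 2) := by
  simp [params]

lemma admissible_sizes {j : ℕ} (hj : 11 ≤ j) {t} (ht : t ∈ params j) :
    Model.Admissible (sizes j t) ∧ 5 + ∑ i, (sizes j t i false + sizes j t i true) = j := by
  obtain ⟨u, r, l, c, b₁, b₂, b₃⟩ := t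
  rw [mem_params] at ht
  cases c <;> simp [Model.Admissible, Fin.forall_fin_succ, Fin.sum_univ_four, sizes, pairSizes] <;>
    omega

lemma sizes_injOn {j : ℕ} {t t'} (ht : t ∈ params j) (ht' : t' ∈ params j)
    (h : sizes j t = sizes j t') : t = t' := by
  obtain ⟨u, r, l, c, b₁, b₂, b₃⟩ := t
  obtain ⟨u', r', l', c', b₁', b₂', b₃'⟩ := t'
  rw [mem_params] at ht ht'
  have h' : ∀ i s, sizes j ⟨u, r, l, c, b₁, b₂, b₃⟩ i s =
      sizes j ⟨u', r', l', c', b₁', b₂', b₃'⟩ i s := fun i s => by rw [h]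
  cases c <;> cases c' <;> simp [Fin.forall_fin_succ, sizes, pairSizes] at h' ⊢ <;> omega

lemma exists_sizes_eq {j : ℕ} {n : Fin 4 → Bool → ℕ} (hn : Model.Admissible n)
    (hj : 5 + ∑ i, (n i false + n i true) = j) : ∃ t ∈ params j, sizes j t = n := by
  obtain ⟨h, h0, h3, h12⟩ := hn
  have e0 := h 0
  have e1 := h 1
  have e2 := h 2
  have e3 := h 3
  rw [Fin.sum_univ_four] at hj
  rcases h12 with ⟨h1, h2⟩ | ⟨h1, h2⟩
  -- The inverse encoding: `u` counts the first interval, the undoubled one and 2 more; `l` counts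
  -- the doubled middle interval and 2 more.
  · refine ⟨⟨n 0 false + n 0 true + n 2 false + 2, n 2 false, n 1 false + n 1 true + 2, false,
      n 0 true, n 1 true, n 3 true⟩, ?_, ?_⟩
    · rw [mem_params]; omega
    · funext i s
      fin_cases i <;> cases s <;> simp [sizes, pairSizes] <;> omega
  · refine ⟨⟨n 0 false + n 0 true + n 1 false + 2, n 1 false, n 2 false + n 2 true + 2, true,
      n 0 true, n 2 true, n 3 true⟩, ?_, ?_⟩
    · rw [mem_params]; omega
    · funext i s
      fin_cases i <;> cases s <;> simp [sizes, pairSizes] <;> omega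

lemma numB_eq_card_params {j : ℕ} (hj : 11 ≤ j) : numB j 5 3 7 = (params j).card := by
  rw [numB, ← Nat.card_eq_finsetCard]
  symm
  refine Nat.card_eq_of_bijective (fun t => Quotient.mk (isoSetoid j 5 3 7)
    ⟨Model.toFiniteLattice (sizes j t) (admissible_sizes hj t.2).2,
      Model.memB_toFiniteLattice (admissible_sizes hj t.2).1 _⟩) ⟨?_, ?_⟩
  · rintro ⟨t, ht⟩ ⟨t', ht'⟩ h
    obtain ⟨e⟩ := Quotient.exact h
    exact Subtype.ext (sizes_injOn ht ht' (Model.eq_of_orderIso (admissible_sizes hj ht).1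
      (admissible_sizes hj ht').1 e))
  · intro q
    induction q using Quotient.ind with | _ M
    obtain ⟨M, hM⟩ := M
    obtain ⟨n, ⟨e⟩, hn, hs⟩ := exists_model_of_memB hM
    obtain ⟨t, ht, rfl⟩ := exists_sizes_eq hn hs
    exact ⟨⟨t, ht⟩, Quotient.sound ⟨e⟩⟩

end Counting

end LatticeCount

theorem mainTheorem6 (j : ℕ) (hj : 11 ≤ j) :
    LatticeCount.numB j 5 3 7 =
      ∑ u ∈ Finset.Icc 4 (j - 7), ∑ r ∈ Finset.Icc 0 (u - 4), ∑ l ∈ Finset.Icc 4 (j - u - 3),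
        2 * LatticeCount.numPartitions (u - r - 2) 2 * LatticeCount.numPartitions (l - 2) 2 *
          LatticeCount.numPartitions (j - u - l - 1) 2 := by
  rw [LatticeCount.numB_eq_card_params hj, LatticeCount.card_params]
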